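/- Let $K$ be a field, $p(X)\in K[X]$ a polynomial and $n\ge 2$. Let $L_n^p$ be the $K$-algebra given by the quiver with vertices $0,1,\dots,n-1$, a loop $\epsilon$ at the vertex $0$, and arrows $a_i:i\to i+1$, $\overline a_i:i+1\to i$ for $0\le i\le n-2$ (paths are composed from left to right), subject to the relations $$a_s\overline a_s+\overline a_{s-1}a_{s-1}=0\ (1\le s\le n-2),\qquad \overline a_{n-2}a_{n-2}=0,\qquad \epsilon^{2n}=0,\qquad \epsilon^2+a_0\overline a_0+\epsilon^3p(\epsilon)=0 .$$ Let $e_i$ be the trivial path at the vertex $i$, let $[A,A]$ denote the $K$-linear span of all $xy-yx$ with $x,y\in A$, and $Z(A)$ the centre of $A$. Let $\mathcal B$ be the set of the following paths, from a vertex $i$ to a vertex $j$ with $i,j\in\{0,\dots,n-1\}$ (empty products of arrows are trivial paths): (1) $a_ia_{i+1}\cdots a_{j-1}$ for $i<j$; (2) $a_ia_{i+1}\cdots a_\ell\overline a_\ell\overline a_{\ell-1}\cdots\overline a_j$ for $i<j\le\ell\le n-2$; (3) $\overline a_{i-1}\overline a_{i-2}\cdots\overline a_j$ for $i\ge j$ (this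 is $e_i$ for $i=j$); (4) $a_ia_{i+1}\cdots a_\ell\overline a_\ell\overline a_{\ell-1}\cdots\overline a_j$ for $j\le i\le\ell\le n-2$; (5) $\overline a_{i-1}\cdots\overline a_0\,\epsilon\, a_0\cdots a_{j-1}$ for all $i,j$; (6) $\overline a_{i-1}\cdots\overline a_0\,\epsilon\, a_0\cdots a_\ell\overline a_\ell\cdots\overline a_j$ for $i<j\le\ell\le n-2$; (7) $a_i\cdots a_\ell\overline a_\ell\cdots\overline a_0\,\epsilon\, a_0\cdots a_{j-1}$ for $j\le i\le\ell\le n-2$. Then the (classes of the) paths in $\mathcal B$ form a $K$-basis of $L_n^p$; in particular $L_n^p$ is finite-dimensional. Moreover: (a) $\dim_K[L_n^p,L_n^p]=\dim_K L_n^p-2n=\frac13 n(n-1)(2n+5)$. (b) $\dim_K Z(L_n^p)=2n$. (c) The cosets of $e_0,\dots,e_{n-1},\epsilon,\epsilon^3,\dots,\epsilon^{2n-1}$ form a $K$-basis of $L_n^p/[L_n^p,L_n^p]$. (d) A $K$-basis of $[L_n^p,L_n^p]$ is given by the following elements: (i) all non-closed paths in $\mathcal B$ (starting vertex different from ending vertex);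 (ii) all closed paths in $\mathcal B$ of even length at least $2$ whose starting vertex is different from $0$; (iii) all differences $x-y$ of two closed paths $x,y\in\mathcal B$ of equal odd length whose starting vertices are $i$ and $i+1$ respectively, where $0\le i\le n-2$; (iv) the elements $a_0a_1\cdots a_\ell\overline a_\ell\overline a_{\ell-1}\cdots\overline a_0$ with $0\le\ell\le n-2$. -/

import Mathlib

open Polynomial

noncomputable section

/-! ### The path algebra of a finite quiver -/

/-- All paths of a quiver: a start vertex, an end vertex, and a path between them. -/
abbrev TotalPath (V : Type*) [Quiver V] : Type _ := Σ i j : V, Quiver.Path i j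

namespace TotalPath

variable {V : Type*} [Quiver V]

/-- The starting vertex of a path. -/
def source (x : TotalPath V) : V := x.1

/-- The ending vertex of a path. -/
def target (x : TotalPath V) : V := x.2.1

/-- The length of a path, i.e. its number of arrows. -/
def length (x : TotalPath V) : ℕ := x.2.2.length

/-- The concatenation "first `x`, then `y`", where it makes sense. -/
def concat? [DecidableEq V] (x y : TotalPath V) : Option (TotalPath V) :=
  if h : y.1 = x.2.1 then some ⟨x.1, y.2.1, x.2.2.comp (y.2.2.cast h rfl)⟩ else none

end TotalPath

/-- The path algebra `KQ` of a quiver `Q` with vertex set `V`: the free `K`-module on all paths.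
The product of two paths is their concatenation (from left to right) if it exists,
and zero otherwise. -/
def PathAlgebra (K : Type*) (V : Type*) [CommRing K] [Quiver V] : Type _ := TotalPath V →₀ K

namespace PathAlgebra

variable {K : Type*} {V : Type*} [CommRing K] [Quiver V]

instance : AddCommGroup (PathAlgebra K V) := inferInstanceAs (AddCommGroup (TotalPath V →₀ K))

instance : Module K (PathAlgebra K V) := inferInstanceAs (Module K (TotalPath V →₀ K))

/-- A path, as an element of the path algebra. -/
def ofTotal (K : Type*) [CommRing K] (x : TotalPath V) : PathAlgebra K V :=
  Finsupp.single x (1 : K)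

/-- A path between given vertices, as an element of the path algebra. -/
def ofPath (K : Type*) [CommRing K] {i j : V} (p : Quiver.Path i j) : PathAlgebra K V :=
  ofTotal K ⟨i, j, p⟩

/-- The linear extension of a map on paths. -/
def lin {M : Type*} [AddCommGroup M] [Module K M] (f : TotalPath V → M) :
    PathAlgebra K V →ₗ[K] M :=
  Finsupp.linearCombination K f

@[simp] lemma lin_ofTotal {M : Type*} [AddCommGroup M] [Module K M] (f : TotalPath V → M)
    (x : TotalPath V) : lin f (ofTotal K x) = f x :=
  (Finsupp.linearCombination_single K (1 : K) x).trans (one_smul K (f x))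

lemma hom_ext {M : Type*} [AddCommGroup M] [Module K M] {f g : PathAlgebra K V →ₗ[K] M}
    (h : ∀ x, f (ofTotal K x) = g (ofTotal K x)) : f = g := by
  refine Finsupp.lhom_ext' fun x => LinearMap.ext_ring ?_
  exact h x

/-- The unit of the path algebra: the sum of all trivial paths. -/
instance [Fintype V] : One (PathAlgebra K V) :=
  ⟨∑ i : V, ofPath K (Quiver.Path.nil : Quiver.Path i i)⟩

lemma one_def [Fintype V] :
    (1 : PathAlgebra K V) = ∑ i : V, ofPath K (Quiver.Path.nil : Quiver.Path i i) := rfl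

variable [DecidableEq V]

/-- The product of two paths in the path algebra. -/
def pathMul (K : Type*) [CommRing K] (x y : TotalPath V) : PathAlgebra K V :=
  (x.concat? y).elim 0 (ofTotal K)

/-- The multiplication of the path algebra, as a bilinear map. -/
def mulHom (K : Type*) (V : Type*) [CommRing K] [Quiver V] [DecidableEq V] :
    PathAlgebra K V →ₗ[K] PathAlgebra K V →ₗ[K] PathAlgebra K V :=
  lin fun x => lin fun y => pathMul K x y

instance : Mul (PathAlgebra K V) := ⟨fun f g => mulHom K V f g⟩

lemma mul_def (f g : PathAlgebra K V) : f * g = mulHom K V f g := rfl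

lemma ofTotal_mul_ofTotal (x y : TotalPath V) :
    ofTotal K x * ofTotal K y = pathMul K x y := by
  simp [mul_def, mulHom]

lemma ofPath_mul_ofPath {i j k : V} (p : Quiver.Path i j) (q : Quiver.Path j k) :
    ofPath K p * ofPath K q = ofPath K (p.comp q) := by
  simp [ofPath, ofTotal_mul_ofTotal, pathMul, TotalPath.concat?]

lemma ofPath_mul_ofPath_of_ne {i j k l : V} (p : Quiver.Path i j) (q : Quiver.Path k l)
    (h : k ≠ j) : ofPath K p * ofPath K q = 0 := by
  simp [ofPath, ofTotal_mul_ofTotal, pathMul, TotalPath.concat?, h]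

lemma mul_assoc_aux (f g h : PathAlgebra K V) : f * g * h = f * (g * h) := by
  have key : ∀ x y z : TotalPath V, ofTotal K x * ofTotal K y * ofTotal K z =
      ofTotal K x * (ofTotal K y * ofTotal K z) := by
    rintro ⟨i, j, p⟩ ⟨k, l, q⟩ ⟨m, o, r⟩
    change ofPath K p * ofPath K q * ofPath K r = ofPath K p * (ofPath K q * ofPath K r)
    by_cases h1 : k = j
    · subst h1
      by_cases h2 : m = l
      · subst h2
        simp only [ofPath_mul_ofPath, Quiver.Path.comp_assoc]
      · rw [ofPath_mul_ofPath, ofPath_mul_ofPath_of_ne _ _ h2, ofPath_mul_ofPath_of_ne _ _ h2]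
        simp [mul_def]
    · rw [ofPath_mul_ofPath_of_ne _ _ h1]
      by_cases h2 : m = l
      · subst h2
        rw [ofPath_mul_ofPath, ofPath_mul_ofPath_of_ne _ _ h1]
        simp [mul_def]
      · rw [ofPath_mul_ofPath_of_ne _ _ h2]
        simp [mul_def]
  have step1 : ∀ x y : TotalPath V, mulHom K V (ofTotal K x * ofTotal K y) =
      mulHom K V (ofTotal K x) ∘ₗ mulHom K V (ofTotal K y) :=
    fun x y => hom_ext fun z => key x y z
  have step2 : ∀ (x : TotalPath V) (h : PathAlgebra K V),
      (mulHom K V).flip h ∘ₗ mulHom K V (ofTotal K x) =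
        mulHom K V (ofTotal K x) ∘ₗ (mulHom K V).flip h :=
    fun x h => hom_ext fun y => LinearMap.congr_fun (step1 x y) h
  have step3 : (mulHom K V).flip h ∘ₗ (mulHom K V).flip g =
      (mulHom K V).flip (g * h) :=
    hom_ext fun x => LinearMap.congr_fun (step2 x h) g
  exact LinearMap.congr_fun step3 f

lemma one_mul_aux [Fintype V] (f : PathAlgebra K V) : 1 * f = f := by
  suffices h : mulHom K V 1 = LinearMap.id from LinearMap.congr_fun h f
  refine hom_ext ?_
  rintro ⟨i, j, p⟩
  change 1 * ofPath K p = ofPath K p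
  rw [one_def, mul_def, map_sum, LinearMap.sum_apply, Finset.sum_eq_single i]
  · rw [← mul_def, ofPath_mul_ofPath, Quiver.Path.nil_comp]
  · intro k _ hk
    rw [← mul_def, ofPath_mul_ofPath_of_ne _ _ hk.symm]
  · simp

lemma mul_one_aux [Fintype V] (f : PathAlgebra K V) : f * 1 = f := by
  suffices h : (mulHom K V).flip 1 = LinearMap.id from LinearMap.congr_fun h f
  refine hom_ext ?_
  rintro ⟨i, j, p⟩
  change ofPath K p * 1 = ofPath K p
  rw [one_def, mul_def, map_sum, Finset.sum_eq_single j]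
  · rw [← mul_def, ofPath_mul_ofPath, Quiver.Path.comp_nil]
  · intro k _ hk
    rw [← mul_def, ofPath_mul_ofPath_of_ne _ _ hk]
  · simp

instance [Fintype V] : Ring (PathAlgebra K V) :=
  { (inferInstance : AddCommGroup (PathAlgebra K V)),
    (inferInstance : Mul (PathAlgebra K V)),
    (inferInstance : One (PathAlgebra K V)) with
    left_distrib := fun f g h => by simp [mul_def]
    right_distrib := fun f g h => by simp [mul_def]
    zero_mul := fun f => by simp [mul_def]
    mul_zero := fun f => by simp [mul_def]
    mul_assoc := mul_assoc_aux
    one_mul := one_mul_aux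
    mul_one := mul_one_aux }

instance [Fintype V] : Algebra K (PathAlgebra K V) :=
  Algebra.ofModule (fun r f g => by simp [mul_def]) (fun r f g => by simp [mul_def])

end PathAlgebra

/-- The commutator space `[A, A]`: the linear span of all `a * b - b * a`. -/
def commutatorSpace (K A : Type*) [CommRing K] [Ring A] [Algebra K A] : Submodule K A :=
  Submodule.span K {x | ∃ a b : A, x = a * b - b * a}

/-! ### The deformed preprojective algebras of type `L` -/

namespace TypeL

open Quiver

/-- The vertices `0, 1, …, n - 1` of the quiver. -/
@[ext] structure Vertex (n : ℕ) where
  idx : ℕ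
  lt : idx < n
  deriving DecidableEq

instance (n : ℕ) : Fintype (Vertex n) :=
  Fintype.ofEquiv (Fin n)
    { toFun := fun i => ⟨i.1, i.2⟩
      invFun := fun i => ⟨i.1, i.2⟩
      left_inv := fun _ => rfl
      right_inv := fun _ => rfl }

/-- The arrows of the quiver: the loop `ε` at the vertex `0`, and for `0 ≤ i ≤ n - 2` the arrows
`a i : i ⟶ i + 1` and `abar i : i + 1 ⟶ i`. -/
inductive Arrow (n : ℕ) : Vertex n → Vertex n → Type
  | eps (h : 0 < n) : Arrow n ⟨0, h⟩ ⟨0, h⟩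
  | a (i : ℕ) (h : i + 1 < n) : Arrow n ⟨i, Nat.lt_of_succ_lt h⟩ ⟨i + 1, h⟩
  | abar (i : ℕ) (h : i + 1 < n) : Arrow n ⟨i + 1, h⟩ ⟨i, Nat.lt_of_succ_lt h⟩

instance (n : ℕ) : Quiver (Vertex n) := ⟨Arrow n⟩

variable {n : ℕ}

/-- The loop `ε` as a path of length one. -/
def eps (h : 0 < n) : Path (⟨0, h⟩ : Vertex n) ⟨0, h⟩ :=
  Hom.toPath (Arrow.eps h : (⟨0, h⟩ : Vertex n) ⟶ ⟨0, h⟩)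

/-- The arrow `a_i` as a path of length one. -/
def a (i : ℕ) (h : i + 1 < n) : Path (⟨i, Nat.lt_of_succ_lt h⟩ : Vertex n) ⟨i + 1, h⟩ :=
  Hom.toPath (Arrow.a i h : (⟨i, Nat.lt_of_succ_lt h⟩ : Vertex n) ⟶ ⟨i + 1, h⟩)

/-- The arrow `ā_i` as a path of length one. -/
def abar (i : ℕ) (h : i + 1 < n) : Path (⟨i + 1, h⟩ : Vertex n) ⟨i, Nat.lt_of_succ_lt h⟩ :=
  Hom.toPath (Arrow.abar i h : (⟨i + 1, h⟩ : Vertex n) ⟶ ⟨i, Nat.lt_of_succ_lt h⟩)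

/-- The path `a_i a_{i+1} ⋯ a_{j-1}` from `i` to `j`, for `i ≤ j` (trivial for `i = j`). -/
def up (i j : ℕ) (hij : i ≤ j) (hj : j < n) :
    Path (⟨i, hij.trans_lt hj⟩ : Vertex n) ⟨j, hj⟩ :=
  Nat.leRec (motive := fun m hm => ∀ h : m < n, Path (⟨i, hm.trans_lt h⟩ : Vertex n) ⟨m, h⟩)
    (fun _ => Path.nil)
    (fun m _ ih h => (ih (Nat.lt_of_succ_lt h)).comp (a m h)) hij hj

/-- The path `ā_{i-1} ā_{i-2} ⋯ ā_j` from `i` to `j`, for `j ≤ i` (trivial for `i = j`). -/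
def down (i j : ℕ) (hij : j ≤ i) (hi : i < n) :
    Path (⟨i, hi⟩ : Vertex n) ⟨j, hij.trans_lt hi⟩ :=
  Nat.leRec (motive := fun m hm => ∀ h : m < n, Path (⟨m, h⟩ : Vertex n) ⟨j, hm.trans_lt h⟩)
    (fun _ => Path.nil)
    (fun m _ ih h => (abar m h).comp (ih (Nat.lt_of_succ_lt h))) hij hi

/-- The defining relations of `L_n^p`, as relations `x = 0` in the path algebra. -/
inductive Rel (K : Type*) [Field K] (n : ℕ) (p : K[X]) :
    PathAlgebra K (Vertex n) → PathAlgebra K (Vertex n) → Prop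
  /-- `a_s ā_s + ā_{s-1} a_{s-1} = 0` for `1 ≤ s ≤ n - 2` (here `s = i + 1`). -/
  | mesh (i : ℕ) (h : i + 2 < n) : Rel K n p
      (PathAlgebra.ofPath K (a (i + 1) h) * PathAlgebra.ofPath K (abar (i + 1) h)
        + PathAlgebra.ofPath K (abar i (Nat.lt_of_succ_lt h))
          * PathAlgebra.ofPath K (a i (Nat.lt_of_succ_lt h))) 0
  /-- `ā_{n-2} a_{n-2} = 0` (here `n - 2 = i`). -/
  | last (i : ℕ) (h : i + 1 < n) (hi : i + 2 = n) : Rel K n p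
      (PathAlgebra.ofPath K (abar i h) * PathAlgebra.ofPath K (a i h)) 0
  /-- `ε^{2n} = 0`. -/
  | nilp (h : 0 < n) : Rel K n p (PathAlgebra.ofPath K (eps h) ^ (2 * n)) 0
  /-- `ε² + a_0 ā_0 + ε³ p(ε) = 0`. -/
  | deformed (h : 0 + 1 < n) : Rel K n p
      (PathAlgebra.ofPath K (eps (Nat.lt_of_succ_lt h)) ^ 2
        + PathAlgebra.ofPath K (a 0 h) * PathAlgebra.ofPath K (abar 0 h)
        + PathAlgebra.ofPath K (eps (Nat.lt_of_succ_lt h)) ^ 3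
          * aeval (PathAlgebra.ofPath K (eps (Nat.lt_of_succ_lt h))) p) 0

/-- The deformed preprojective algebra `L_n^p`: the quotient of the path algebra by the two-sided
ideal generated by the defining relations. -/
abbrev L (K : Type*) [Field K] (n : ℕ) (p : K[X]) : Type _ := RingQuot (Rel K n p)

/-- The canonical projection from the path algebra to `L_n^p`. -/
def proj (K : Type*) [Field K] (n : ℕ) (p : K[X]) :
    PathAlgebra K (Vertex n) →ₐ[K] L K n p :=
  RingQuot.mkAlgHom K (Rel K n p)

/-- The path set `𝓑`. -/
inductive IsStandard : TotalPath (Vertex n) → Prop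
  /-- `a_i a_{i+1} ⋯ a_{j-1}` for `i < j`. -/
  | type1 (i j : ℕ) (hij : i < j) (hj : j < n) :
      IsStandard ⟨_, _, up i j hij.le hj⟩
  /-- `a_i a_{i+1} ⋯ a_l ā_l ā_{l-1} ⋯ ā_j` for `i < j ≤ l ≤ n - 2`. -/
  | type2 (i j l : ℕ) (hij : i < j) (hjl : j ≤ l) (hl : l + 1 < n) :
      IsStandard ⟨_, _, (up i (l + 1) ((hij.le.trans hjl).trans l.le_succ) hl).comp
        (down (l + 1) j (hjl.trans l.le_succ) hl)⟩
  /-- `ā_{i-1} ā_{i-2} ⋯ ā_j` for `i ≥ j`; for `i = j` this is the trivial path `e_i`. -/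
  | type3 (i j : ℕ) (hij : j ≤ i) (hi : i < n) :
      IsStandard ⟨_, _, down i j hij hi⟩
  /-- `a_i a_{i+1} ⋯ a_l ā_l ā_{l-1} ⋯ ā_j` for `j ≤ i ≤ l ≤ n - 2`. -/
  | type4 (i j l : ℕ) (hij : j ≤ i) (hil : i ≤ l) (hl : l + 1 < n) :
      IsStandard ⟨_, _, (up i (l + 1) (hil.trans l.le_succ) hl).comp
        (down (l + 1) j ((hij.trans hil).trans l.le_succ) hl)⟩
  /-- `ā_{i-1} ⋯ ā_0 ε a_0 ⋯ a_{j-1}` for all `i`, `j`. -/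
  | type5 (i j : ℕ) (hi : i < n) (hj : j < n) :
      IsStandard ⟨_, _, ((down i 0 i.zero_le hi).comp (eps (i.zero_le.trans_lt hi))).comp
        (up 0 j j.zero_le hj)⟩
  /-- `ā_{i-1} ⋯ ā_0 ε a_0 ⋯ a_l ā_l ⋯ ā_j` for `i < j ≤ l ≤ n - 2`. -/
  | type6 (i j l : ℕ) (hij : i < j) (hjl : j ≤ l) (hl : l + 1 < n) :
      IsStandard ⟨_, _,
        (((down i 0 i.zero_le (((hij.le.trans hjl).trans l.le_succ).trans_lt hl)).comp
          (eps ((Nat.zero_le _).trans_lt hl))).comp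
          (up 0 (l + 1) (Nat.zero_le _) hl)).comp (down (l + 1) j (hjl.trans l.le_succ) hl)⟩
  /-- `a_i ⋯ a_l ā_l ⋯ ā_0 ε a_0 ⋯ a_{j-1}` for `j ≤ i ≤ l ≤ n - 2`. -/
  | type7 (i j l : ℕ) (hij : j ≤ i) (hil : i ≤ l) (hl : l + 1 < n) :
      IsStandard ⟨_, _,
        (((up i (l + 1) (hil.trans l.le_succ) hl).comp
          (down (l + 1) 0 (Nat.zero_le _) hl)).comp
          (eps ((Nat.zero_le _).trans_lt hl))).comp
          (up 0 j j.zero_le (((hij.trans hil).trans l.le_succ).trans_lt hl))⟩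

/-- The elements (written in the path algebra) that form the basis of the commutator space. -/
inductive IsCommutatorBasisElt (K : Type*) [Field K] (n : ℕ) : PathAlgebra K (Vertex n) → Prop
  /-- The non-closed paths in `𝓑`. -/
  | nonclosed (x : TotalPath (Vertex n)) (hx : IsStandard x) (h : x.source ≠ x.target) :
      IsCommutatorBasisElt K n (PathAlgebra.ofTotal K x)
  /-- The closed paths in `𝓑` of even length at least `2` at a vertex different from `0`. -/
  | evenClosed (x : TotalPath (Vertex n)) (hx : IsStandard x) (hc : x.source = x.target)
      (heven : Even x.length) (hlen : 2 ≤ x.length) (h0 : x.source.idx ≠ 0) :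
      IsCommutatorBasisElt K n (PathAlgebra.ofTotal K x)
  /-- The differences of two closed paths in `𝓑` of equal odd length with consecutive
  starting vertices `i` and `i + 1`. -/
  | oddDiff (x y : TotalPath (Vertex n)) (hx : IsStandard x) (hy : IsStandard y)
      (hcx : x.source = x.target) (hcy : y.source = y.target)
      (hlen : x.length = y.length) (hodd : Odd x.length)
      (hcons : y.source.idx = x.source.idx + 1) :
      IsCommutatorBasisElt K n (PathAlgebra.ofTotal K x - PathAlgebra.ofTotal K y)
  /-- The elements `a_0 a_1 ⋯ a_l ā_l ā_{l-1} ⋯ ā_0` for `0 ≤ l ≤ n - 2`. -/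
  | zeroClosed (l : ℕ) (hl : l + 1 < n) :
      IsCommutatorBasisElt K n (PathAlgebra.ofPath K
        ((up 0 (l + 1) (Nat.zero_le _) hl).comp (down (l + 1) 0 (Nat.zero_le _) hl)))

end TypeL

end

/-! Spanning. Let `a` be the sum of the `a_i`, `b` the sum of the `(-1)^i ā_i`, and `ξ = a b`. With
these signs the mesh relations, together with the relation at the vertex `n - 1`, become `b a = ξ -
e_0 ξ`. It follows that `ξ` is central, and the deformed relation reads `e_0 ξ = -(ε² + ε³ p(ε))`.
The span of the monomials `e_i a^r ξ^k`, `e_i b^r ξ^k`, `b^i ε a^j ξ^k` is stable under right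
multiplication by the generators, and each nonzero monomial is, up to sign, a path in `𝓑`
(`gens_W_eq_top`, `stdElt_even`, `stdElt_odd`).

Independence. Let `R = K[y]/(y^{2n})` and `x = -(y² + y³ p(y))`; the elements `x^m`, `x^m y` with `m
< n` form a basis of `R`. Send `a_i`, `ā_i`, `ε` to the matrix units with coefficients `1`, `(-1)^i
x`, `y`. All relations hold except `ā_{n-2} a_{n-2} = 0`. A closed path at `n - 1` must descend to
`0` before it can use `ε`, so its weight is `f(x) + x^{n-1} r`. Multiplied by `x` this becomes `x
f(x)`, because `x^n = 0`. Hence the trace followed by the map `o : R → K^n` that reads off the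
coefficients of the `x^m y` kills the whole ideal and descends to a trace function `τ` on the
algebra (`oddTrace_rel`, `exists_oddTrace`). The form `τ(u v)_{n-1}` vanishes on pairs of paths
without `ε` and pairs the paths through `ε` with their duals without `ε`, so `𝓑` is independent and
the form is nondegenerate.

Commutators. The listed elements are commutators up to telescoping, and together with the `2n`
proposed coset representatives they span (`commSpan_le`, `commSpan_sup_eq_top`). Conversely, `τ` and
the `n` characters given by the trivial paths map the algebra onto `K^n × K^n` and kill commutators
(`finrank_quotient_ge`). So the quotient has dimension exactly `2n`, and counting turns the spanning
sets into bases. The centre is the orthogonal complement of the commutator space, which gives its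
dimension. -/

noncomputable section

/-! ### Representations of a quiver and maps out of quotient algebras -/

namespace PathAlgebra

/-- A representation of a quiver in an algebra: orthogonal idempotents with sum `1` for the
vertices, and an element of the corresponding corner for every arrow. -/
structure Rep (V B : Type*) [Quiver V] [Fintype V] [Ring B] where
  e : V → B
  w : ∀ {i j : V}, (i ⟶ j) → B
  e_mul_self : ∀ i, e i * e i = e i
  e_mul_of_ne : ∀ i j, i ≠ j → e i * e j = 0
  sum_e : ∑ i, e i = 1
  e_mul_w : ∀ {i j : V} (f : i ⟶ j), e i * w f = w f
  w_mul_e : ∀ {i j : V} (f : i ⟶ j), w f * e j = w f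

namespace Rep

variable {V B : Type*} [Quiver V] [Fintype V] [Ring B] (ρ : Rep V B)

/-- The value of a representation on a path. -/
def val {i : V} : ∀ {j : V}, Quiver.Path i j → B
  | _, .nil => ρ.e i
  | _, .cons q f => val q * ρ.w f

lemma e_mul_val {i j : V} (q : Quiver.Path i j) : ρ.e i * ρ.val q = ρ.val q := by
  induction q with
  | nil => exact ρ.e_mul_self i
  | cons q f ih => rw [val, ← mul_assoc, ih]

lemma val_mul_e {i j : V} (q : Quiver.Path i j) : ρ.val q * ρ.e j = ρ.val q := by
  cases q with
  | nil => exact ρ.e_mul_self i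
  | cons q f => rw [val, mul_assoc, ρ.w_mul_e]

lemma val_comp {i j k : V} (q : Quiver.Path i j) (r : Quiver.Path j k) :
    ρ.val (q.comp r) = ρ.val q * ρ.val r := by
  induction r with
  | nil => rw [Quiver.Path.comp_nil]; exact (ρ.val_mul_e q).symm
  | cons r f ih => rw [Quiver.Path.comp_cons, val, val, ih, mul_assoc]

lemma val_toPath {i j : V} (f : i ⟶ j) : ρ.val f.toPath = ρ.w f := ρ.e_mul_w f

lemma val_mul_val_of_ne {i j k l : V} (q : Quiver.Path i j) (r : Quiver.Path k l) (h : k ≠ j) :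
    ρ.val q * ρ.val r = 0 := by
  rw [← ρ.val_mul_e q, ← ρ.e_mul_val r, mul_assoc, ← mul_assoc (ρ.e j),
    ρ.e_mul_of_ne _ _ h.symm, zero_mul, mul_zero]

variable {K : Type*} [CommRing K] [DecidableEq V] [Algebra K B]

variable (K) in
/-- The algebra homomorphism from the path algebra defined by a representation. -/
def lift : PathAlgebra K V →ₐ[K] B :=
  AlgHom.ofLinearMap (lin fun x => ρ.val x.2.2)
    (by
      rw [one_def, map_sum, ← ρ.sum_e]
      exact Finset.sum_congr rfl fun i _ => lin_ofTotal _ _)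
    (by
      set F : PathAlgebra K V →ₗ[K] B := lin fun x => ρ.val x.2.2 with hF
      have key : ∀ x y : TotalPath V,
          F (ofTotal K x * ofTotal K y) = F (ofTotal K x) * F (ofTotal K y) := by
        rintro ⟨i, j, q⟩ ⟨k, l, r⟩
        by_cases h : k = j
        · subst h
          have := ofPath_mul_ofPath (K := K) q r
          simp only [ofPath] at this
          rw [this, hF, lin_ofTotal, lin_ofTotal, lin_ofTotal, val_comp]
        · have := ofPath_mul_ofPath_of_ne (K := K) q r h
          simp only [ofPath] at this
          rw [this, hF, lin_ofTotal, lin_ofTotal, map_zero, ρ.val_mul_val_of_ne q r h]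
      have key2 : ∀ x : TotalPath V, F ∘ₗ mulHom K V (ofTotal K x) =
          LinearMap.mulLeft K (F (ofTotal K x)) ∘ₗ F :=
        fun x => hom_ext fun y => key x y
      intro f g
      have key3 : F ∘ₗ (mulHom K V).flip g = LinearMap.mulRight K (F g) ∘ₗ F :=
        hom_ext fun x => LinearMap.congr_fun (key2 x) g
      exact LinearMap.congr_fun key3 f)

lemma lift_ofPath {i j : V} (q : Quiver.Path i j) : ρ.lift K (ofPath K q) = ρ.val q :=
  lin_ofTotal _ _

lemma lift_ofTotal (x : TotalPath V) : ρ.lift K (ofTotal K x) = ρ.val x.2.2 :=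
  lin_ofTotal _ _

end Rep

variable {K V : Type*} [CommRing K] [Quiver V]

lemma span_ofTotal :
    Submodule.span K (Set.range (ofTotal K : TotalPath V → PathAlgebra K V)) = ⊤ := by
  have h : Submodule.span K (Set.range fun x : TotalPath V => Finsupp.single x (1 : K)) = ⊤ := by
    have := (Finsupp.basisSingleOne (R := K) (ι := TotalPath V)).span_eq
    simpa only [Finsupp.coe_basisSingleOne] using this
  exact h

/-- Induction on the elements of a path algebra as linear combinations of paths. -/
@[elab_as_elim]
lemma induction_paths {P : PathAlgebra K V → Prop} (z : PathAlgebra K V)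
    (path : ∀ x, P (ofTotal K x)) (zero : P 0) (add : ∀ x y, P x → P y → P (x + y))
    (smul : ∀ (c : K) x, P x → P (c • x)) : P z := by
  have hz : z ∈ Submodule.span K (Set.range (ofTotal K : TotalPath V → PathAlgebra K V)) := by
    rw [span_ofTotal]; trivial
  induction hz using Submodule.span_induction with
  | mem x hx => obtain ⟨y, rfl⟩ := hx; exact path y
  | zero => exact zero
  | add x y _ _ hx hy => exact add x y hx hy
  | smul c x _ hx => exact smul c x hx

end PathAlgebra

/-- A linear map on a `K`-algebra that does not distinguish the two sides of a relation inside any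
product descends to the quotient algebra. -/
theorem RingQuot.exists_linear_factor {K P M : Type*} [CommRing K] [Ring P] [Algebra K P]
    [AddCommGroup M] [Module K M] (r : P → P → Prop) (f : P →ₗ[K] M)
    (h : ∀ x y, r x y → ∀ u v, f (u * x * v) = f (u * y * v)) :
    ∃ g : RingQuot r →ₗ[K] M, ∀ z, g (RingQuot.mkAlgHom K r z) = f z := by
  -- The syntactic congruence of `f`. It contains the relations by hypothesis, and `f` is constant
  -- on its classes (take `u = v = 1`).
  let c : RingCon P :=
    { r := fun x y => ∀ u v, f (u * x * v) = f (u * y * v)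
      iseqv := ⟨fun _ _ _ => rfl, fun h u v => (h u v).symm,
        fun h h' u v => (h u v).trans (h' u v)⟩
      mul' := by
        intro x y x' y' h h' u v
        rw [← mul_assoc u, mul_assoc _ x' v, h, ← mul_assoc, h', ← mul_assoc]
      add' := by
        intro x y x' y' h h' u v
        rw [mul_add, add_mul, map_add, h, h', ← map_add, ← add_mul, ← mul_add] }
  let m : P →ₐ[K] c.Quotient :=
    { c.mk' with commutes' := fun _ => rfl }
  have hm : ∀ x y, m x = m y → f x = f y := by
    intro x y hxy
    have := (RingCon.eq c).1 hxy 1 1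
    simpa using this
  let φ : RingQuot r →ₐ[K] c.Quotient :=
    RingQuot.liftAlgHom K ⟨m, fun x y hxy => (RingCon.eq c).2 (h x y hxy)⟩
  have hφ : ∀ z, φ (RingQuot.mkAlgHom K r z) = m z := fun z =>
    RingQuot.liftAlgHom_mkAlgHom_apply K m _ z
  obtain ⟨s, hs⟩ := Function.Surjective.hasRightInverse (RingQuot.mkAlgHom_surjective K r)
  have hf : ∀ x y, RingQuot.mkAlgHom K r x = RingQuot.mkAlgHom K r y → f x = f y := by
    intro x y hxy
    exact hm _ _ (by rw [← hφ, ← hφ, hxy])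
  refine ⟨{ toFun := fun q => f (s q), map_add' := ?_, map_smul' := ?_ }, fun z => hf _ _ (hs _)⟩
  · intro x y
    rw [← map_add]
    exact hf _ _ (by rw [hs, map_add, hs, hs])
  · intro k x
    rw [RingHom.id_apply, ← map_smul]
    exact hf _ _ (by rw [hs, map_smul, hs])

/-! ### Leading terms in powers of a nilpotent element -/

section NilpotentElement

variable {K A : Type*} [Field K] [Ring A] [Algebra K A]

/-- If a submodule contains, for every `d`, an element of the form `y ^ d` plus higher powers
of the nilpotent element `y`, then it contains all powers of `y`. -/
lemma pow_mem_of_leading_terms (y : A) (N : ℕ) (hN : y ^ N = 0) (W : Submodule K A)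
    (h : ∀ d, ∃ q : K[X], y ^ d * (1 + y * aeval y q) ∈ W) (d : ℕ) : y ^ d ∈ W := by
  -- Downward induction on the exponent `d`, starting from the vanishing powers.
  suffices H : ∀ m d, N ≤ d + m → y ^ d ∈ W from H N d (Nat.le_add_left _ _)
  intro m
  induction m with
  | zero =>
    intro d hd
    rw [add_zero] at hd
    rw [pow_eq_zero_of_le hd hN]
    exact W.zero_mem
  | succ m ih =>
    intro d hd
    obtain ⟨q, hq⟩ := h d
    have h1 : y ^ d * (y * aeval y q) ∈ W := by
      rw [aeval_eq_sum_range, Finset.mul_sum, Finset.mul_sum]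
      refine W.sum_mem fun i _ => ?_
      rw [mul_smul_comm, mul_smul_comm, ← pow_succ', ← pow_add]
      exact W.smul_mem _ (ih _ (by omega))
    have h2 := W.sub_mem hq h1
    rwa [mul_add, mul_one, add_sub_cancel_right] at h2

/-- The powers of `-(y² + y³ p(y))` have even order in `y`. -/
lemma neg_sq_add_cube_pow (p : K[X]) (l : ℕ) : ∃ q : K[X], ∀ y : A,
    (-(y ^ 2 + y ^ 3 * aeval y p)) ^ l = (-1 : K) ^ l • (y ^ (2 * l) * (1 + y * aeval y q)) := by
  obtain ⟨q, hq⟩ : (X : K[X]) ∣ (1 + X * p) ^ l - 1 := by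
    have h := sub_dvd_pow_sub_pow (1 + X * p) 1 l
    rw [one_pow, add_sub_cancel_left] at h
    exact (Dvd.intro p rfl).trans h
  refine ⟨q, fun y => ?_⟩
  have hpoly : (-(X ^ 2 + X ^ 3 * p) : K[X]) ^ l =
      (-1 : K) ^ l • (X ^ (2 * l) * (1 + X * q)) := by
    rw [← hq, add_sub_cancel, show -(X ^ 2 + X ^ 3 * p) = (-1 : K[X]) * (X ^ 2 * (1 + X * p)) by
      ring, mul_pow, mul_pow, ← pow_mul, smul_eq_C_mul]
    simp
  simpa using congrArg (aeval y) hpoly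

/-- With `x = -(y² + y³ p(y))`, the elements `x^l` and `x^l y` have leading terms `±y^{2l}` and
`±y^{2l+1}`, so every exponent occurs as a leading one. -/
lemma pow_mem_span_pow_mul (p : K[X]) (y : A) (n : ℕ) (hy : y ^ (2 * n) = 0) (d : ℕ) : y ^ d ∈ Submodule.span K
    (Set.range fun m : ℕ => (-(y ^ 2 + y ^ 3 * aeval y p)) ^ m) ⊔ Submodule.span K
    (Set.range fun m : ℕ => (-(y ^ 2 + y ^ 3 * aeval y p)) ^ m * y) := by
  refine pow_mem_of_leading_terms y _ hy _ (fun d => ?_) d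
  obtain ⟨l, hl⟩ := Nat.even_or_odd' d
  obtain ⟨q, hq⟩ := neg_sq_add_cube_pow (A := A) p l
  refine ⟨q, ?_⟩
  have hu : ((-1 : K) ^ l) * (-1) ^ l = 1 := by rw [← mul_pow]; simp
  have h1 : y ^ (2 * l) * (1 + y * aeval y q) =
      (-1 : K) ^ l • (-(y ^ 2 + y ^ 3 * aeval y p)) ^ l := by
    rw [hq, smul_smul, hu, one_smul]
  rcases hl with rfl | rfl
  · rw [h1]
    exact Submodule.mem_sup_left (Submodule.smul_mem _ _ (Submodule.subset_span ⟨l, rfl⟩))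
  · have hc : Commute y (aeval y q) := by
      simpa using (Commute.all (X : K[X]) q).map (aeval y)
    have h2 : y ^ (2 * l + 1) * (1 + y * aeval y q) =
        (-1 : K) ^ l • ((-(y ^ 2 + y ^ 3 * aeval y p)) ^ l * y) := by
      have : Commute y (1 + y * aeval y q) :=
        (Commute.one_right y).add_right ((Commute.refl y).mul_right hc)
      rw [← smul_mul_assoc, ← h1, pow_succ, mul_assoc, mul_assoc, this.eq]
    rw [h2]
    exact Submodule.mem_sup_right (Submodule.smul_mem _ _ (Submodule.subset_span ⟨l, rfl⟩))

/-- The variant for the cosets of the odd powers of `ε`: even exponents are led by powers of `-(y² +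
y³ p(y))`, odd ones by themselves. -/
lemma pow_mem_span_pow_odd (p : K[X]) (y : A) (n : ℕ) (hy : y ^ (2 * n) = 0) (d : ℕ) : y ^ d ∈ Submodule.span K
    (Set.range fun m : ℕ => (-(y ^ 2 + y ^ 3 * aeval y p)) ^ m) ⊔ Submodule.span K
    (Set.range fun l : Fin n => y ^ (2 * (l : ℕ) + 1)) := by
  refine pow_mem_of_leading_terms y _ hy _ (fun d => ?_) d
  obtain ⟨l, rfl | rfl⟩ := Nat.even_or_odd' d
  · obtain ⟨q, hq⟩ := neg_sq_add_cube_pow (A := A) p l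
    refine ⟨q, ?_⟩
    have hu : ((-1 : K) ^ l) * (-1) ^ l = 1 := by rw [← mul_pow]; simp
    have h1 : y ^ (2 * l) * (1 + y * aeval y q) =
        (-1 : K) ^ l • (-(y ^ 2 + y ^ 3 * aeval y p)) ^ l := by
      rw [hq, smul_smul, hu, one_smul]
    rw [h1]
    exact Submodule.mem_sup_left (Submodule.smul_mem _ _ (Submodule.subset_span ⟨l, rfl⟩))
  · refine ⟨0, ?_⟩
    rw [map_zero, mul_zero, add_zero, mul_one]
    by_cases hl : l < n
    · exact Submodule.mem_sup_right (Submodule.subset_span ⟨⟨l, hl⟩, rfl⟩)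
    · rw [pow_eq_zero_of_le (show 2 * n ≤ 2 * l + 1 by omega) hy]
      exact Submodule.zero_mem _

lemma neg_sq_add_cube_pow_eq_zero (p : K[X]) (y : A) (n : ℕ) (hy : y ^ (2 * n) = 0) {m : ℕ} (hm : n ≤ m) :
    (-(y ^ 2 + y ^ 3 * aeval y p)) ^ m = 0 := by
  obtain ⟨q, hq⟩ := neg_sq_add_cube_pow (A := A) p m
  rw [hq, pow_eq_zero_of_le (by omega) hy, zero_mul, smul_zero]

end NilpotentElement

/-- A commutative model of the corner `K[ε] / (ε ^ {2n})`, together with the functional reading off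
the odd part. -/
theorem exists_oddPart {K : Type*} [Field K] (p : K[X]) (n : ℕ) :
    ∃ (y : AdjoinRoot (X ^ (2 * n) : K[X]))
      (o : AdjoinRoot (X ^ (2 * n) : K[X]) →ₗ[K] (Fin n → K)),
      y ^ (2 * n) = 0 ∧ (-(y ^ 2 + y ^ 3 * aeval y p)) ^ n = 0 ∧
      (∀ m, o ((-(y ^ 2 + y ^ 3 * aeval y p)) ^ m) = 0) ∧
      ∀ m : Fin n, o ((-(y ^ 2 + y ^ 3 * aeval y p)) ^ (m : ℕ) * y) = Pi.single m 1 := by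
  set R := AdjoinRoot (X ^ (2 * n) : K[X])
  set y : R := AdjoinRoot.root _ with hy_def
  have hne : (X ^ (2 * n) : K[X]) ≠ 0 := pow_ne_zero _ X_ne_zero
  have hy : y ^ (2 * n) = 0 := by
    have := AdjoinRoot.eval₂_root (X ^ (2 * n) : K[X])
    simpa using this
  set x : R := -(y ^ 2 + y ^ 3 * aeval y p) with hx
  have hxn : ∀ m, n ≤ m → x ^ m = 0 := fun m hm => neg_sq_add_cube_pow_eq_zero p y n hy hm
  let v : Fin n ⊕ Fin n → R := Sum.elim (fun m => x ^ (m : ℕ)) (fun m => x ^ (m : ℕ) * y)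
  have hspan : ⊤ ≤ Submodule.span K (Set.range v) := by
    have hpow : ∀ d, y ^ d ∈ Submodule.span K (Set.range v) := by
      intro d
      refine (sup_le ?_ ?_ : _ ≤ Submodule.span K (Set.range v)) (pow_mem_span_pow_mul p y n hy d)
      · rw [Submodule.span_le]
        rintro _ ⟨m, rfl⟩
        by_cases hm : m < n
        · exact Submodule.subset_span ⟨Sum.inl ⟨m, hm⟩, rfl⟩
        · change x ^ m ∈ _
          rw [hxn m (by omega)]
          exact Submodule.zero_mem _
      · rw [Submodule.span_le]
        rintro _ ⟨m, rfl⟩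
        by_cases hm : m < n
        · exact Submodule.subset_span ⟨Sum.inr ⟨m, hm⟩, rfl⟩
        · change x ^ m * y ∈ _
          rw [hxn m (by omega), zero_mul]
          exact Submodule.zero_mem _
    intro r _
    obtain ⟨f, rfl⟩ := AdjoinRoot.mk_surjective r
    rw [← AdjoinRoot.aeval_eq, aeval_eq_sum_range]
    exact Submodule.sum_mem _ fun i _ => Submodule.smul_mem _ _ (hpow i)
  -- The `2n` spanning vectors match the dimension `2n`, so they form a basis and `o` may be
  -- prescribed on them.
  have hcard : Fintype.card (Fin n ⊕ Fin n) = Module.finrank K R := by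
    rw [(AdjoinRoot.powerBasis hne).finrank, AdjoinRoot.powerBasis_dim, natDegree_X_pow]
    simp [two_mul]
  let b := basisOfTopLeSpanOfCardEqFinrank v hspan hcard
  have hb : ∀ i, b i = v i := fun i => by simp [b]
  refine ⟨y, b.constr K (Sum.elim (fun _ => 0) fun m => Pi.single m 1), hy, hxn n le_rfl, ?_, ?_⟩
  · intro m
    by_cases hm : m < n
    · have h := b.constr_basis K (Sum.elim (fun _ => 0) fun m => Pi.single m (1 : K))
        (Sum.inl ⟨m, hm⟩)
      rw [hb] at h
      exact h
    · rw [hxn m (by omega), map_zero]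
  · intro m
    have h := b.constr_basis K (Sum.elim (fun _ => 0) fun m => Pi.single m (1 : K)) (Sum.inr m)
    rw [hb] at h
    exact h

/-! ### Combinatorics of `𝓑`: cells, lengths and signs -/

namespace TypeL
open Quiver

variable {n : ℕ}

lemma up_self (i : ℕ) (hi : i < n) : up i i le_rfl hi = Path.nil := by
  simp [up]

lemma up_succ (i j : ℕ) (hij : i ≤ j) (hj : j + 1 < n) :
    up i (j + 1) (hij.trans j.le_succ) hj = (up i j hij (Nat.lt_of_succ_lt hj)).comp (a j hj) := by
  simp only [up]
  rw [Nat.leRec_succ]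

lemma down_self (i : ℕ) (hi : i < n) : down i i le_rfl hi = Path.nil := by
  simp [down]

lemma down_succ (i j : ℕ) (hij : j ≤ i) (hi : i + 1 < n) :
    down (i + 1) j (hij.trans i.le_succ) hi =
      (abar i hi).comp (down i j hij (Nat.lt_of_succ_lt hi)) := by
  simp only [down]
  rw [Nat.leRec_succ]

/-- Triples `(top, row, col)` with `row, col ≤ top < n`. They index the paths in `𝓑` in which `ε`
does not occur, and also those in which it does. -/
@[ext] structure Cell (n : ℕ) where
  top : ℕ
  row : ℕ
  col : ℕ
  row_le : row ≤ top
  col_le : col ≤ top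
  top_lt : top < n
  deriving DecidableEq

namespace Cell

/-- Cells as a sigma type. -/
def equivSigma (n : ℕ) : Cell n ≃ Σ m : Fin n, Fin (m + 1) × Fin (m + 1) where
  toFun c := ⟨⟨c.top, c.top_lt⟩, ⟨c.row, Nat.lt_succ_of_le c.row_le⟩,
    ⟨c.col, Nat.lt_succ_of_le c.col_le⟩⟩
  invFun s := ⟨s.1, s.2.1, s.2.2, Nat.le_of_lt_succ s.2.1.2, Nat.le_of_lt_succ s.2.2.2, s.1.2⟩
  left_inv _ := rfl
  right_inv _ := rfl

instance : Fintype (Cell n) := Fintype.ofEquiv _ (equivSigma n).symm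

lemma card_cell : (Fintype.card (Cell n) : ℚ) = n * (n + 1) * (2 * n + 1) / 6 := by
  rw [Fintype.card_congr (equivSigma n), Fintype.card_sigma]
  simp only [Fintype.card_prod, Fintype.card_fin]
  rw [Fin.sum_univ_eq_sum_range (fun m => (m + 1) * (m + 1))]
  induction n with
  | zero => simp
  | succ k ih =>
    rw [Finset.sum_range_succ]
    push_cast at ih ⊢
    rw [ih]
    ring

lemma row_lt (c : Cell n) : c.row < n := c.row_le.trans_lt c.top_lt

lemma col_lt (c : Cell n) : c.col < n := c.col_le.trans_lt c.top_lt

/-- The starting vertex of the paths indexed by a cell. -/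
def src (c : Cell n) : Vertex n := ⟨c.row, c.row_lt⟩

/-- The ending vertex of the paths indexed by a cell. -/
def tgt (c : Cell n) : Vertex n := ⟨c.col, c.col_lt⟩

/-- The cell of the even path that pairs nontrivially with the odd path of a given cell. -/
def dual (c : Cell n) : Cell n where
  -- Chosen so that the weights of the odd path of `c` and of the even path of its dual multiply to
  -- `±x^{n-1} y`.
  top := n - 1 + max c.row c.col - c.top
  row := c.col
  col := c.row
  row_le := by have := c.top_lt; omega
  col_le := by have := c.top_lt; omega
  top_lt := by have := c.top_lt; have := c.row_le; have := c.col_le; omega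

lemma dual_dual (c : Cell n) : c.dual.dual = c := by
  have := c.top_lt; have := c.row_le; have := c.col_le
  ext <;> simp [dual]
  omega

end Cell

/-- The path `a_i ⋯ a_{m-1} ā_{m-1} ⋯ ā_j` for a cell `(m, i, j)`. -/
def evenPath (c : Cell n) : TotalPath (Vertex n) :=
  ⟨_, _, (up c.row c.top c.row_le c.top_lt).comp (down c.top c.col c.col_le c.top_lt)⟩

/-- The path in `𝓑` through `ε` for a cell `(m, i, j)`: it is
`ā_{i-1} ⋯ ā_0 ε a_0 ⋯ a_{m-1} ā_{m-1} ⋯ ā_j` for `i < j` and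
`a_i ⋯ a_{m-1} ā_{m-1} ⋯ ā_0 ε a_0 ⋯ a_{j-1}` for `j ≤ i`. -/
def oddPath (c : Cell n) : TotalPath (Vertex n) :=
  if c.row < c.col then
    ⟨_, _, (((down c.row 0 (Nat.zero_le _) c.row_lt).comp (eps (Nat.zero_lt_of_lt c.top_lt))).comp
      (up 0 c.top (Nat.zero_le _) c.top_lt)).comp (down c.top c.col c.col_le c.top_lt)⟩
  else
    ⟨_, _, (((up c.row c.top c.row_le c.top_lt).comp
      (down c.top 0 (Nat.zero_le _) c.top_lt)).comp (eps (Nat.zero_lt_of_lt c.top_lt))).comp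
      (up 0 c.col (Nat.zero_le _) c.col_lt)⟩

lemma oddPath_source (c : Cell n) : (oddPath c).source = c.src := by
  unfold oddPath; split_ifs <;> rfl

lemma oddPath_target (c : Cell n) : (oddPath c).target = c.tgt := by
  unfold oddPath; split_ifs <;> rfl

lemma length_up (i j : ℕ) (hij : i ≤ j) (hj : j < n) : (up i j hij hj).length = j - i := by
  induction j, hij using Nat.le_induction with
  | base => rw [up_self]; simp
  | succ j hij ih =>
    rw [up_succ i j hij hj, Path.length_comp, ih]
    simp [a]; omega

lemma length_down (i j : ℕ) (hij : j ≤ i) (hi : i < n) : (down i j hij hi).length = i - j := by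
  induction i, hij using Nat.le_induction with
  | base => rw [down_self]; simp
  | succ i hij ih =>
    rw [down_succ i j hij hi, Path.length_comp, ih]
    simp [abar]; omega

lemma length_evenPath (c : Cell n) :
    (evenPath c).length = (c.top - c.row) + (c.top - c.col) := by
  simp [evenPath, TotalPath.length, Path.length_comp, length_up, length_down]

lemma length_oddPath (c : Cell n) (h : c.row = c.col) : (oddPath c).length = 2 * c.top + 1 := by
  have := c.col_le
  rw [oddPath, if_neg (by omega)]
  simp [TotalPath.length, Path.length_comp, length_up, length_down, eps]
  omega

/-- The paths in `𝓑`, indexed by two copies of the cells. -/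
def std : Cell n ⊕ Cell n → TotalPath (Vertex n) := Sum.elim evenPath oddPath

lemma isStandard_evenPath (c : Cell n) : IsStandard (evenPath c) := by
  obtain ⟨m, i, j, hi, hj, hm⟩ := c
  simp only [evenPath]
  by_cases hij : i < j
  · rcases hj.eq_or_lt with rfl | h
    · rw [down_self, Path.comp_nil]
      exact IsStandard.type1 i j hij hm
    · obtain ⟨l, rfl⟩ : ∃ l, m = l + 1 := ⟨m - 1, by omega⟩
      exact IsStandard.type2 i j l hij (by omega) hm
  · rcases hi.eq_or_lt with rfl | h
    · rw [up_self, Path.nil_comp]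
      exact IsStandard.type3 i j (by omega) hm
    · obtain ⟨l, rfl⟩ : ∃ l, m = l + 1 := ⟨m - 1, by omega⟩
      exact IsStandard.type4 i j l (by omega) (by omega) hm

lemma isStandard_oddPath (c : Cell n) : IsStandard (oddPath c) := by
  obtain ⟨m, i, j, hi, hj, hm⟩ := c
  simp only [oddPath]
  split_ifs with hij
  · rcases hj.eq_or_lt with rfl | h
    · rw [down_self, Path.comp_nil]
      exact IsStandard.type5 i j _ hm
    · obtain ⟨l, rfl⟩ : ∃ l, m = l + 1 := ⟨m - 1, by omega⟩
      exact IsStandard.type6 i j l hij (by omega) hm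
  · rcases hi.eq_or_lt with rfl | h
    · rw [up_self, Path.nil_comp]
      exact IsStandard.type5 i j hm _
    · obtain ⟨l, rfl⟩ : ∃ l, m = l + 1 := ⟨m - 1, by omega⟩
      exact IsStandard.type7 i j l (by omega) (by omega) hm

lemma isStandard_std (q : Cell n ⊕ Cell n) : IsStandard (std q) := by
  rcases q with c | c
  · exact isStandard_evenPath c
  · exact isStandard_oddPath c

lemma exists_std_eq {x : TotalPath (Vertex n)} (hx : IsStandard x) : ∃ q, std q = x := by
  cases hx with
  | type1 i j hij hj =>
    refine ⟨Sum.inl ⟨j, i, j, hij.le, le_rfl, hj⟩, ?_⟩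
    simp only [std, Sum.elim_inl, evenPath]
    rw [down_self, Path.comp_nil]
  | type2 i j l hij hjl hl =>
    exact ⟨Sum.inl ⟨l + 1, i, j, by omega, by omega, hl⟩, rfl⟩
  | type3 i j hij hi =>
    refine ⟨Sum.inl ⟨i, i, j, le_rfl, hij, hi⟩, ?_⟩
    simp only [std, Sum.elim_inl, evenPath]
    rw [up_self, Path.nil_comp]
  | type4 i j l hij hil hl =>
    exact ⟨Sum.inl ⟨l + 1, i, j, by omega, by omega, hl⟩, rfl⟩
  | type5 i j hi hj =>
    by_cases hij : i < j
    · refine ⟨Sum.inr ⟨j, i, j, hij.le, le_rfl, hj⟩, ?_⟩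
      simp only [std, Sum.elim_inr, oddPath]
      rw [if_pos hij, down_self, Path.comp_nil]
    · refine ⟨Sum.inr ⟨i, i, j, le_rfl, by omega, hi⟩, ?_⟩
      simp only [std, Sum.elim_inr, oddPath]
      rw [if_neg hij, up_self, Path.nil_comp]
  | type6 i j l hij hjl hl =>
    refine ⟨Sum.inr ⟨l + 1, i, j, by omega, by omega, hl⟩, ?_⟩
    simp only [std, Sum.elim_inr, oddPath]
    rw [if_pos hij]
  | type7 i j l hij hil hl =>
    refine ⟨Sum.inr ⟨l + 1, i, j, by omega, by omega, hl⟩, ?_⟩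
    simp only [std, Sum.elim_inr, oddPath]
    rw [if_neg (by omega)]

/-- The sign `∏ (-1) ^ t` over `j ≤ t < i` relating `ā_{i-1} ⋯ ā_j` to its normalization. -/
def sgn (K : Type*) [Field K] (i j : ℕ) : K := ∏ t ∈ Finset.Ico j i, (-1) ^ t

lemma sgn_ne_zero (K : Type*) [Field K] (i j : ℕ) : sgn K i j ≠ 0 :=
  Finset.prod_ne_zero_iff.2 fun _ _ => pow_ne_zero _ (neg_ne_zero.2 one_ne_zero)

lemma sgn_self (K : Type*) [Field K] (i : ℕ) : sgn K i i = 1 := by simp [sgn]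

lemma sgn_succ (K : Type*) [Field K] {i j : ℕ} (h : j ≤ i) :
    sgn K (i + 1) j = (-1) ^ i * sgn K i j := by
  rw [sgn, Finset.prod_Ico_succ_top h, mul_comm]; rfl

/-- The sign relating the path `oddPath c` to its normalization. -/
def oddSgn (K : Type*) [Field K] (c : Cell n) : K :=
  if c.row < c.col then sgn K c.row 0 * sgn K c.top c.col else sgn K c.top 0

lemma oddSgn_ne_zero (K : Type*) [Field K] (c : Cell n) : oddSgn K c ≠ 0 := by
  unfold oddSgn
  split_ifs
  · exact mul_ne_zero (sgn_ne_zero _ _ _) (sgn_ne_zero _ _ _)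
  · exact sgn_ne_zero _ _ _

end TypeL

/-! ### Matrix weights and the odd part of the trace -/

namespace TypeL
open Quiver PathAlgebra

variable {n : ℕ} {K R : Type*} [Field K] [CommRing R] [Algebra K R]

variable (K) in
/-- The weights of the arrows: `1` for `a_i`, `(-1) ^ i x` for `ā_i`, and `y` for `ε`. -/
def arrowWeight (x y : R) : ∀ {i j : Vertex n}, Arrow n i j → R
  | _, _, .eps _ => y
  | _, _, .a _ _ => 1
  | _, _, .abar i _ => (-1 : K) ^ i • x

variable (K) in
/-- The weight of a path: the product of the weights of its arrows. -/
def pathWeight (x y : R) {i : Vertex n} : ∀ {j : Vertex n}, Path i j → R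
  | _, .nil => 1
  | _, .cons q f => pathWeight x y q * arrowWeight K x y f

variable (n K) in
/-- The matrix representation in which an arrow acts by its weight. -/
def matRep (x y : R) : Rep (Vertex n) (Matrix (Vertex n) (Vertex n) R) where
  e i := Matrix.single i i 1
  w {i j} f := Matrix.single i j (arrowWeight K x y f)
  e_mul_self i := by simp
  e_mul_of_ne i j h := Matrix.single_mul_single_of_ne _ _ _ _ h _
  sum_e := Matrix.sum_single_one
  e_mul_w f := by simp
  w_mul_e f := by simp

lemma matRep_val (x y : R) {i j : Vertex n} (q : Path i j) :
    (matRep n K x y).val q = Matrix.single i j (pathWeight K x y q) := by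
  induction q with
  | nil => rfl
  | cons q f ih => rw [Rep.val, ih, pathWeight]; simp [matRep]

lemma pathWeight_comp (x y : R) {i j k : Vertex n} (q : Path i j) (r : Path j k) :
    pathWeight K x y (q.comp r) = pathWeight K x y q * pathWeight K x y r := by
  induction r with
  | nil => simp [pathWeight]
  | cons r f ih => rw [Path.comp_cons, pathWeight, pathWeight, ih, mul_assoc]

lemma pathWeight_a (x y : R) (i : ℕ) (h : i + 1 < n) : pathWeight K x y (a i h) = 1 := by
  simp [a, Hom.toPath, pathWeight, arrowWeight]

lemma pathWeight_abar (x y : R) (i : ℕ) (h : i + 1 < n) :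
    pathWeight K x y (abar i h) = (-1 : K) ^ i • x := by
  simp [abar, Hom.toPath, pathWeight, arrowWeight]

lemma pathWeight_eps (x y : R) (h : 0 < n) : pathWeight K x y (eps h) = y := by
  simp [eps, Hom.toPath, pathWeight, arrowWeight]

lemma pathWeight_up (x y : R) (i j : ℕ) (hij : i ≤ j) (hj : j < n) :
    pathWeight K x y (up i j hij hj) = 1 := by
  induction j, hij using Nat.le_induction with
  | base => rw [up_self]; rfl
  | succ j hij ih => rw [up_succ i j hij hj, pathWeight_comp, ih, pathWeight_a, one_mul]

lemma pathWeight_down (x y : R) (i j : ℕ) (hij : j ≤ i) (hi : i < n) :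
    pathWeight K x y (down i j hij hi) = sgn K i j • x ^ (i - j) := by
  induction i, hij using Nat.le_induction with
  | base => rw [down_self, sgn_self]; simp [pathWeight]
  | succ i hij ih =>
    rw [down_succ i j hij hi, pathWeight_comp, ih, pathWeight_abar, sgn_succ K hij,
      smul_mul_smul_comm, Nat.succ_sub hij, pow_succ']

/-- Each descent costs a factor `x`, and a factor `y` can only be acquired at the vertex `0`, after
at least `i` descents. The subtraction is truncated: a path ending above its start need not have
descended. -/
lemma exists_pathWeight_eq (x y : R) {i j : Vertex n} (q : Path i j) :
    ∃ (f : K[X]) (r : R),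
      pathWeight K x y q = x ^ (i.idx - j.idx) * aeval x f + x ^ i.idx * r := by
  induction q with
  | nil => exact ⟨1, 0, by simp [pathWeight]⟩
  | cons q f ih =>
    obtain ⟨g, r, hr⟩ := ih
    rw [pathWeight, hr]
    have key : ∀ k l : ℕ, l ≤ k → ∃ h : K[X], x ^ k = x ^ l * aeval x h := fun k l hl =>
      ⟨X ^ (k - l), by rw [map_pow, aeval_X, ← pow_add, Nat.add_sub_cancel' hl]⟩
    change Arrow n _ _ at f
    cases f with
    | eps h =>
      exact ⟨0, (aeval x g + r) * y, by simp [arrowWeight]; ring⟩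
    | a m h =>
      obtain ⟨u, hu⟩ := key (i.idx - m) (i.idx - (m + 1)) (by omega)
      refine ⟨u * g, r, ?_⟩
      simp only [arrowWeight, mul_one, map_mul]
      rw [hu, mul_assoc]
    | abar m h =>
      obtain ⟨u, hu⟩ := key (i.idx - (m + 1) + 1) (i.idx - m) (by omega)
      refine ⟨C ((-1) ^ m) * (u * g), (-1 : K) ^ m • x * r, ?_⟩
      simp only [arrowWeight, map_mul, aeval_C]
      rw [Algebra.smul_def]
      have : x ^ (i.idx - (m + 1)) * x = x ^ (i.idx - m) * aeval x u := by rw [← hu, pow_succ]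
      linear_combination (algebraMap K R ((-1) ^ m) * aeval x g) * this

variable (p : K[X]) (x y : R) (o : R →ₗ[K] (Fin n → K))

/-- The functional "odd part of the trace" on the path algebra. -/
def oddTrace : PathAlgebra K (Vertex n) →ₗ[K] (Fin n → K) :=
  o ∘ₗ Matrix.traceLinearMap (Vertex n) K R ∘ₗ ((matRep n K x y).lift K).toLinearMap

lemma oddTrace_apply (z : PathAlgebra K (Vertex n)) :
    oddTrace x y o z = o ((matRep n K x y).lift K z).trace := rfl

lemma oddTrace_mul_comm (u v : PathAlgebra K (Vertex n)) :
    oddTrace x y o (u * v) = oddTrace x y o (v * u) := by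
  rw [oddTrace_apply, oddTrace_apply, map_mul, map_mul, Matrix.trace_mul_comm]

/-- The trace property moves `v` to the front, so only left multiples matter. For all relations but
`last` the matrices themselves agree. -/
lemma oddTrace_rel (hx : x = -(y ^ 2 + y ^ 3 * aeval y p)) (hy : y ^ (2 * n) = 0)
    (hxn : x ^ n = 0) (ho : ∀ m, o (x ^ m) = 0) {r s : PathAlgebra K (Vertex n)}
    (h : Rel K n p r s) (u v : PathAlgebra K (Vertex n)) :
    oddTrace x y o (u * r * v) = oddTrace x y o (u * s * v) := by
  -- Only positive exponents: the zeroth power is the full identity matrix, not the matrix unit. For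
  -- the same reason the factor `y ^ 3` is kept next to `aeval` in `hq` below.
  have hpow : ∀ (i : Vertex n) (c : R) (m : ℕ),
      Matrix.single i i c ^ (m + 1) = Matrix.single i i (c ^ (m + 1)) := by
    intro i c m
    induction m with
    | zero => simp
    | succ m ih => rw [pow_succ, ih, Matrix.single_mul_single_same, ← pow_succ]
  suffices H : ∀ z, oddTrace x y o (z * r) = oddTrace x y o (z * s) by
    rw [oddTrace_mul_comm, ← mul_assoc, H, mul_assoc, oddTrace_mul_comm]
  intro z
  rw [oddTrace_apply, oddTrace_apply, map_mul, map_mul]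
  cases h with
  | mesh i h =>
    congr 3
    rw [map_add, map_mul, map_mul, map_zero]
    simp only [Rep.lift_ofPath, matRep_val, Matrix.single_mul_single_same, pathWeight_a,
      pathWeight_abar]
    rw [← Matrix.single_add]
    simp [pow_succ]
  | nilp h =>
    congr 3
    obtain ⟨m, hm⟩ : ∃ m, 2 * n = m + 1 := ⟨2 * n - 1, by omega⟩
    rw [map_pow, map_zero, Rep.lift_ofPath, matRep_val, hm, hpow, ← hm, pathWeight_eps, hy,
      Matrix.single_zero]
  | deformed h =>
    congr 3
    have hq : ∀ (i : Vertex n) (q : K[X]), Matrix.single i i y ^ 3 *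
        aeval (Matrix.single i i y) q = Matrix.single i i (y ^ 3 * aeval y q) := by
      intro i q
      induction q using Polynomial.induction_on' with
      | add f g hf hg => rw [map_add, mul_add, hf, hg, map_add, mul_add, Matrix.single_add]
      | monomial m c =>
        rw [aeval_monomial, aeval_monomial, ← Algebra.smul_def, ← Algebra.smul_def,
          mul_smul_comm, mul_smul_comm, ← pow_add, ← pow_add, show 3 + m = (m + 2) + 1 by ring,
          hpow, Matrix.smul_single]
    rw [map_add, map_add, map_zero, map_mul, map_mul, map_pow, map_pow, ← aeval_algHom_apply]
    simp only [Rep.lift_ofPath, matRep_val, Matrix.single_mul_single_same, pathWeight_a,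
      pathWeight_abar, pathWeight_eps]
    rw [hq, hpow, ← Matrix.single_add, ← Matrix.single_add, hx]
    rw [← Matrix.single_zero (⟨0, Nat.lt_of_succ_lt h⟩ : Vertex n) (⟨0, Nat.lt_of_succ_lt h⟩ : Vertex n)]
    congr 1
    simp
  -- The matrix here is `±x` at the diagonal position `n - 1`, not zero. Only closed paths at `n -
  -- 1` contribute to the trace; times `x`, their weight `f(x) + x^{n-1} r` becomes `x f(x)`, which
  -- `o` kills.
  | last i h hi =>
    rw [map_zero, mul_zero, map_mul, Rep.lift_ofPath, Rep.lift_ofPath, matRep_val, matRep_val,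
      Matrix.single_mul_single_same, pathWeight_a, pathWeight_abar, mul_one]
    have hox : ∀ f : K[X], o (x * aeval x f) = 0 := by
      intro f
      rw [aeval_eq_sum_range, Finset.mul_sum, map_sum]
      refine Finset.sum_eq_zero fun k _ => ?_
      rw [mul_smul_comm, map_smul, ← pow_succ', ho, smul_zero]
    rw [Matrix.trace_zero, map_zero]
    induction z using induction_paths with
    | path x =>
      obtain ⟨j, k, q⟩ := x
      rw [Rep.lift_ofTotal, matRep_val]
      dsimp only
      by_cases hk : k = ⟨i + 1, h⟩
      · subst hk
        rw [Matrix.single_mul_single_same]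
        by_cases hj : j = ⟨i + 1, h⟩
        · subst hj
          obtain ⟨f, r, hr⟩ := exists_pathWeight_eq (K := K) x y q
          have : x ^ (i + 1) * x = 0 := by rw [← pow_succ, show i + 1 + 1 = n from hi, hxn]
          rw [Matrix.trace_single_eq_same, hr, mul_smul_comm, map_smul]
          simp only [Nat.sub_self, pow_zero, one_mul]
          rw [show (aeval x f + x ^ (i + 1) * r) * x = x * aeval x f by
            linear_combination r * this, hox, smul_zero]
        · rw [Matrix.trace_single_eq_of_ne _ _ _ hj, map_zero]
      · rw [Matrix.single_mul_single_of_ne _ _ _ _ hk, Matrix.trace_zero, map_zero]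
    | zero => rw [map_zero, zero_mul, Matrix.trace_zero, map_zero]
    | add u v hu hv =>
      rw [map_add, add_mul, Matrix.trace_add, map_add, hu, hv, add_zero]
    | smul c u hu =>
      rw [map_smul, smul_mul_assoc, Matrix.trace_smul, map_smul, hu, smul_zero]

lemma lift_evenPath (c : Cell n) : (matRep n K x y).lift K (ofTotal K (evenPath c)) =
    Matrix.single c.src c.tgt (sgn K c.top c.col • x ^ (c.top - c.col)) := by
  rw [Rep.lift_ofTotal, matRep_val, evenPath, pathWeight_comp, pathWeight_up, pathWeight_down,
    one_mul]
  rfl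

lemma lift_oddPath (c : Cell n) : (matRep n K x y).lift K (ofTotal K (oddPath c)) =
    Matrix.single c.src c.tgt (oddSgn K c • (x ^ (c.row + c.top - max c.row c.col) * y)) := by
  have := c.col_le
  have := c.row_le
  rw [oddPath, oddSgn]
  split_ifs with h
  · rw [Rep.lift_ofTotal, matRep_val]
    simp only [pathWeight_comp, pathWeight_up, pathWeight_down, pathWeight_eps, mul_one]
    rw [smul_mul_assoc, smul_mul_smul_comm, max_eq_right h.le,
      show c.row + c.top - c.col = (c.row - 0) + (c.top - c.col) by omega, pow_add]
    congr 2
    ring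
  · rw [Rep.lift_ofTotal, matRep_val]
    simp only [pathWeight_comp, pathWeight_up, pathWeight_down, pathWeight_eps, mul_one, one_mul]
    rw [smul_mul_assoc, max_eq_left (by omega), Nat.add_sub_cancel_left, Nat.sub_zero]
    rfl

end TypeL

/-! ### The trace function on the algebra and its symmetric form -/

namespace TypeL
open Quiver PathAlgebra

variable (K : Type*) [Field K] (p : K[X]) (n : ℕ)

/-- A path in `𝓑` as an element of `L_n^p`. -/
def stdElt (q : Cell n ⊕ Cell n) : L K n p := proj K n p (ofTotal K (std q))

/-- A product of two even paths has a power of `x` as weight, with no odd part. If the endpoints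
match, the odd path of `c` times the even path of the dual of `d` has weight `±x^{n-1+c.top-d.top}
y`. Its coordinate `n - 1` survives only for equal tops: a smaller exponent lands in another
coordinate, a larger one gives zero. -/
theorem exists_oddTrace : ∃ τ : L K n p →ₗ[K] (Fin n → K),
    (∀ u v, τ (u * v) = τ (v * u)) ∧
    (∀ c d, τ (stdElt K p n (.inl c) * stdElt K p n (.inl d)) = 0) ∧
    (∀ (c d : Cell n) (h : n - 1 < n), c ≠ d →
      τ (stdElt K p n (.inr c) * stdElt K p n (.inl d.dual)) ⟨n - 1, h⟩ = 0) ∧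
    (∀ (c : Cell n) (h : n - 1 < n),
      τ (stdElt K p n (.inr c) * stdElt K p n (.inl c.dual)) ⟨n - 1, h⟩ ≠ 0) ∧
    (∀ c : Cell n, c.row = c.col →
      τ (stdElt K p n (.inr c)) = oddSgn K c • Pi.single ⟨c.top, c.top_lt⟩ 1) := by
  obtain ⟨y, o, hy, hxn, ho, ho'⟩ := exists_oddPart p n
  obtain ⟨x, hx⟩ : ∃ x, x = -(y ^ 2 + y ^ 3 * aeval y p) := ⟨_, rfl⟩
  rw [← hx] at hxn
  simp only [← hx] at ho ho'
  obtain ⟨τ, hτ⟩ := RingQuot.exists_linear_factor (Rel K n p) (oddTrace x y o)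
    fun r s h u v => oddTrace_rel p x y o hx hy hxn ho h u v
  replace hτ : ∀ z, τ (proj K n p z) = o ((matRep n K x y).lift K z).trace := hτ
  have hsurj : Function.Surjective (proj K n p) := RingQuot.mkAlgHom_surjective K _
  have hoe : ∀ (c d : Cell n), τ (stdElt K p n (.inr c) * stdElt K p n (.inl d.dual)) =
      if d.tgt = c.tgt ∧ d.src = c.src then
        (oddSgn K c * sgn K d.dual.top d.dual.col) •
          o (x ^ (c.row + c.top - max c.row c.col + (d.dual.top - d.row)) * y) else 0 := by
    intro c d
    rw [stdElt, stdElt, ← map_mul, hτ, map_mul]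
    simp only [std, Sum.elim_inl, Sum.elim_inr]
    rw [lift_evenPath, lift_oddPath]
    change o (Matrix.trace (Matrix.single c.src c.tgt _ * Matrix.single d.tgt d.src _)) = _
    by_cases h1 : d.tgt = c.tgt
    · rw [← h1, Matrix.single_mul_single_same]
      by_cases h2 : d.src = c.src
      · rw [if_pos ⟨rfl, h2⟩, ← h2, Matrix.trace_single_eq_same, smul_mul_smul_comm, map_smul,
          pow_add, mul_right_comm]
        rfl
      · rw [if_neg (fun h => h2 h.2), Matrix.trace_single_eq_of_ne _ _ _ (Ne.symm h2), map_zero]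
    · rw [if_neg (fun h => h1 h.1), Matrix.single_mul_single_of_ne _ _ _ _ (Ne.symm h1),
        Matrix.trace_zero, map_zero]
  refine ⟨τ, ?_, ?_, ?_, ?_, ?_⟩
  · intro u v
    obtain ⟨u, rfl⟩ := hsurj u
    obtain ⟨v, rfl⟩ := hsurj v
    rw [← map_mul, ← map_mul, hτ, hτ, map_mul, map_mul, Matrix.trace_mul_comm]
  · intro c d
    rw [stdElt, stdElt, ← map_mul, hτ, map_mul]
    simp only [std, Sum.elim_inl]
    rw [lift_evenPath, lift_evenPath]
    by_cases h1 : d.src = c.tgt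
    · rw [h1, Matrix.single_mul_single_same]
      by_cases h2 : c.src = d.tgt
      · rw [h2, Matrix.trace_single_eq_same, smul_mul_smul_comm, map_smul, ← pow_add, ho, smul_zero]
      · rw [Matrix.trace_single_eq_of_ne _ _ _ h2, map_zero]
    · rw [Matrix.single_mul_single_of_ne _ _ _ _ (Ne.symm h1), Matrix.trace_zero, map_zero]
  · intro c d h hcd
    rw [hoe]
    split_ifs with hsd
    · have h1 : d.col = c.col := congrArg Vertex.idx hsd.1
      have h2 : d.row = c.row := congrArg Vertex.idx hsd.2
      have htop : c.top ≠ d.top := fun ht => hcd (Cell.ext ht h2.symm h1.symm)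
      have := c.row_le; have := c.col_le; have := d.row_le; have := d.col_le
      have := c.top_lt; have := d.top_lt
      have hm : c.row + c.top - max c.row c.col + (d.dual.top - d.row) = n - 1 + c.top - d.top := by
        simp only [Cell.dual]; omega
      rw [hm]
      rcases lt_or_gt_of_ne htop with hlt | hgt
      · rw [ho' ⟨n - 1 + c.top - d.top, by omega⟩, Pi.smul_apply, Pi.single_eq_of_ne, smul_zero]
        intro he
        have := congrArg Fin.val he
        simp only at this
        omega
      · rw [pow_eq_zero_of_le (show n ≤ _ by omega) hxn, zero_mul, map_zero, smul_zero]
        rfl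
    · rfl
  · intro c h
    have := c.row_le; have := c.col_le; have := c.top_lt
    rw [hoe, if_pos ⟨rfl, rfl⟩]
    have hm : c.row + c.top - max c.row c.col + (c.dual.top - c.row) = n - 1 := by
      simp only [Cell.dual]; omega
    rw [hm, ho' ⟨n - 1, h⟩, Pi.smul_apply, Pi.single_eq_same, smul_eq_mul, mul_one]
    exact mul_ne_zero (oddSgn_ne_zero _ _) (sgn_ne_zero _ _ _)
  · intro c hc
    have hst : c.src = c.tgt := Vertex.ext hc
    rw [stdElt, hτ]
    simp only [std, Sum.elim_inr]
    rw [lift_oddPath, hst, Matrix.trace_single_eq_same, map_smul, hc, max_self,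
      Nat.add_sub_cancel_left, ho' ⟨c.top, c.top_lt⟩]

variable {K p n}

/-- The form `(u, v) ↦ τ (u v)_{n-1}` is nondegenerate on the span of `𝓑`. -/
lemma coeff_eq_zero_of_oddTrace {τ : L K n p →ₗ[K] (Fin n → K)} (h : n - 1 < n)
    (hcomm : ∀ u v, τ (u * v) = τ (v * u))
    (hee : ∀ c d, τ (stdElt K p n (.inl c) * stdElt K p n (.inl d)) = 0)
    (hne : ∀ (c d : Cell n), c ≠ d →
      τ (stdElt K p n (.inr c) * stdElt K p n (.inl d.dual)) ⟨n - 1, h⟩ = 0)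
    (heq : ∀ c : Cell n,
      τ (stdElt K p n (.inr c) * stdElt K p n (.inl c.dual)) ⟨n - 1, h⟩ ≠ 0)
    (g : Cell n ⊕ Cell n → K)
    (hg : ∀ w, τ ((∑ q, g q • stdElt K p n q) * w) ⟨n - 1, h⟩ = 0) : g = 0 := by
  have hexp : ∀ w, (∑ c, g (.inl c) * τ (stdElt K p n (.inl c) * w) ⟨n - 1, h⟩) +
      ∑ c, g (.inr c) * τ (stdElt K p n (.inr c) * w) ⟨n - 1, h⟩ = 0 := by
    intro w
    rw [← hg w, Finset.sum_mul, map_sum, Finset.sum_apply, Fintype.sum_sum_type]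
    simp only [smul_mul_assoc, map_smul, Pi.smul_apply, smul_eq_mul]
  -- Pairing with even paths annihilates the even part and isolates one odd coefficient. With the
  -- odd part gone, pairing with odd paths isolates the even coefficients.
  have hodd : ∀ d, g (.inr d) = 0 := by
    intro d
    have h1 := hexp (stdElt K p n (.inl d.dual))
    rw [Finset.sum_eq_zero fun c _ => by rw [hee, Pi.zero_apply, mul_zero], zero_add,
      Finset.sum_eq_single d (fun c _ hc => by rw [hne c d hc, mul_zero]) (by simp)] at h1
    exact (mul_eq_zero.1 h1).resolve_right (heq d)
  have heven : ∀ d, g (.inl d) = 0 := by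
    intro d
    have h1 := hexp (stdElt K p n (.inr d.dual))
    rw [Finset.sum_eq_zero (s := Finset.univ) (f := fun c => g (.inr c) * _)
        fun c _ => by rw [hodd, zero_mul], add_zero,
      Finset.sum_eq_single d (fun c _ hc => ?_) (by simp)] at h1
    · refine (mul_eq_zero.1 h1).resolve_right ?_
      have := heq d.dual
      rwa [Cell.dual_dual, hcomm] at this
    · have := hne d.dual c.dual (fun he => hc (by rw [← c.dual_dual, ← he, d.dual_dual]))
      rw [Cell.dual_dual] at this
      rw [hcomm, this, mul_zero]
  funext q
  rcases q with c | c
  · exact heven c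
  · exact hodd c

end TypeL

/-! ### The central element and normal forms derived from the relations -/

namespace TypeL

/-- Elements of an algebra satisfying the relations of `L_n^p`: the vertex idempotents `E i`, the
sum `a` of the arrows `a_i`, the signed sum `b` of the arrows `ā_i`, and the loop `ε`. -/
structure Gens (K A : Type*) [Field K] [Ring A] [Algebra K A] (p : K[X]) (n : ℕ) where
  E : ℕ → A
  a : A
  b : A
  ε : A
  E_mul_self : ∀ i, E i * E i = E i
  E_mul_of_ne : ∀ i j, i ≠ j → E i * E j = 0
  E_eq_zero : ∀ i, n ≤ i → E i = 0
  sum_E : ∑ i ∈ Finset.range n, E i = 1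
  E_mul_a : ∀ i, E i * a = a * E (i + 1)
  a_mul_E_zero : a * E 0 = 0
  b_mul_E : ∀ i, b * E i = E (i + 1) * b
  E_zero_mul_b : E 0 * b = 0
  ε_mul_E : ε * E 0 = ε
  E_mul_ε : E 0 * ε = ε
  mesh : b * a = a * b - E 0 * (a * b)
  deformed : E 0 * (a * b) = -(ε ^ 2 + ε ^ 3 * aeval ε p)
  nilp : ε ^ (2 * n) = 0

namespace Gens

variable {K A : Type*} [Field K] [Ring A] [Algebra K A] {p : K[X]} {n : ℕ} (G : Gens K A p n)

/-- The central element `a b`. -/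
def ξ : A := G.a * G.b

lemma commute_E (i : ℕ) : Commute G.ξ (G.E i) := by
  rw [Commute, SemiconjBy, ξ, mul_assoc, G.b_mul_E, ← mul_assoc, ← mul_assoc, G.E_mul_a]

/-- The correction term in `b a = ξ - E 0 * ξ` disappears because `a * E 0 = 0`. For `b` it
disappears because `E 0 * b = 0`, and for `ε` centrality holds because `E 0 * ξ` is a polynomial in
`ε`. -/
lemma commute_a : Commute G.ξ G.a := by
  rw [Commute, SemiconjBy, ξ, mul_assoc, G.mesh, mul_sub, ← mul_assoc G.a (G.E 0), G.a_mul_E_zero,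
    zero_mul, sub_zero]

lemma commute_b : Commute G.ξ G.b := by
  have h : G.E 0 * (G.a * G.b) * G.b = 0 := by
    have := G.commute_E 0
    rw [ξ] at this
    rw [← this.eq, mul_assoc, G.E_zero_mul_b, mul_zero]
  rw [Commute, SemiconjBy, ξ, ← mul_assoc G.b, G.mesh, sub_mul, h, sub_zero]

lemma ε_commute : Commute G.ε (-(G.ε ^ 2 + G.ε ^ 3 * aeval G.ε p)) := by
  have h : Commute G.ε (aeval G.ε p) := by
    simpa using (Commute.all (X : K[X]) p).map (aeval G.ε)
  exact (((Commute.refl _).pow_right 2).add_right (((Commute.refl _).pow_right 3).mul_right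
    h)).neg_right

lemma commute_ε : Commute G.ξ G.ε := by
  have h1 : G.ξ * G.ε = -(G.ε ^ 2 + G.ε ^ 3 * aeval G.ε p) * G.ε := by
    rw [← G.deformed]
    conv_lhs => rw [← G.E_mul_ε]
    rw [← mul_assoc, (G.commute_E 0).eq, ξ]
  have h2 : G.ε * G.ξ = G.ε * -(G.ε ^ 2 + G.ε ^ 3 * aeval G.ε p) := by
    rw [← G.deformed]
    conv_lhs => rw [← G.ε_mul_E]
    rw [mul_assoc, ξ]
  rw [Commute, SemiconjBy, h1, h2, G.ε_commute.eq]

lemma E_mul_a_pow (i r : ℕ) : G.E i * G.a ^ r = G.a ^ r * G.E (i + r) := by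
  induction r with
  | zero => simp
  | succ r ih => rw [pow_succ, ← mul_assoc, ih, mul_assoc, G.E_mul_a, ← mul_assoc]; rfl

lemma b_pow_mul_E (i r : ℕ) : G.b ^ r * G.E i = G.E (i + r) * G.b ^ r := by
  induction r with
  | zero => simp
  | succ r ih => rw [pow_succ', mul_assoc, ih, ← mul_assoc, G.b_mul_E, mul_assoc]; rfl

lemma E_mul_b_pow_eq_zero {i r : ℕ} (h : i < r) : G.E i * G.b ^ r = 0 := by
  induction r generalizing i with
  | zero => omega
  | succ r ih =>
    rw [pow_succ', ← mul_assoc]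
    cases i with
    | zero => rw [G.E_zero_mul_b, zero_mul]
    | succ i => rw [← G.b_mul_E, mul_assoc, ih (by omega), mul_zero]

lemma a_pow_mul_b_pow (r : ℕ) : G.a ^ r * G.b ^ r = G.ξ ^ r := by
  induction r with
  | zero => simp
  | succ r ih =>
    rw [pow_succ', pow_succ, mul_assoc, ← mul_assoc (G.a ^ r), ih, (G.commute_b.pow_left r).eq,
      ← mul_assoc, ← ξ, ← pow_succ']

/-- Since `ξ^k = a^k b^k`, the product climbs `k` steps from `i` and leaves the quiver. This is what
bounds the tops of cells by `n`. -/
lemma E_mul_ξ_pow_eq_zero {i k : ℕ} (h : n ≤ i + k) : G.E i * G.ξ ^ k = 0 := by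
  rw [← G.a_pow_mul_b_pow, ← mul_assoc, G.E_mul_a_pow, G.E_eq_zero _ h, mul_zero, zero_mul]

lemma E_mul_b_pow_mul_ε (i : ℕ) : G.E i * (G.b ^ i * G.ε) = G.b ^ i * G.ε := by
  have := G.b_pow_mul_E 0 i
  rw [zero_add] at this
  rw [← mul_assoc, ← this, mul_assoc, G.E_mul_ε]

lemma ε_mul_a_pow_mul_E (j : ℕ) : G.ε * G.a ^ j * G.E j = G.ε * G.a ^ j := by
  have := G.E_mul_a_pow 0 j
  rw [zero_add] at this
  rw [mul_assoc, ← this, ← mul_assoc, G.ε_mul_E]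

/-- The normalized even path of a cell. -/
def even (c : Cell n) : A := G.E c.row * G.a ^ (c.top - c.row) * G.b ^ (c.top - c.col)

/-- The normalized odd path of a cell. -/
def odd (c : Cell n) : A := G.b ^ c.row * G.ε * G.a ^ c.col * G.ξ ^ (c.top - max c.row c.col)

lemma even_of_le (c : Cell n) (h : c.row ≤ c.col) :
    G.even c = G.E c.row * G.a ^ (c.col - c.row) * G.ξ ^ (c.top - c.col) := by
  have := c.col_le
  rw [even, show c.top - c.row = (c.col - c.row) + (c.top - c.col) by omega, pow_add, ← mul_assoc,
    mul_assoc _ (G.a ^ _) (G.b ^ _), G.a_pow_mul_b_pow]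

lemma even_of_ge (c : Cell n) (h : c.col ≤ c.row) :
    G.even c = G.E c.row * G.b ^ (c.row - c.col) * G.ξ ^ (c.top - c.row) := by
  have := c.row_le
  rw [even, show c.top - c.col = (c.top - c.row) + (c.row - c.col) by omega, pow_add,
    mul_assoc, ← mul_assoc (G.a ^ _), G.a_pow_mul_b_pow, mul_assoc,
    ((G.commute_b.pow_left _).pow_right _).eq]

/-- The submodule spanned by the normalized paths. -/
def W : Submodule K A := Submodule.span K (Set.range G.even ∪ Set.range G.odd)

lemma E_a_ξ_mem (i r k : ℕ) : G.E i * G.a ^ r * G.ξ ^ k ∈ G.W := by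
  by_cases h : i + r + k < n
  · refine Submodule.subset_span (Or.inl ⟨⟨i + r + k, i, i + r, by omega, by omega, h⟩, ?_⟩)
    rw [even_of_le _ _ (by simp)]
    simp
  · rw [G.E_mul_a_pow, mul_assoc, G.E_mul_ξ_pow_eq_zero (by omega), mul_zero]
    exact G.W.zero_mem

lemma E_b_ξ_mem (i r k : ℕ) : G.E i * G.b ^ r * G.ξ ^ k ∈ G.W := by
  by_cases hr : r ≤ i
  · by_cases h : i + k < n
    · refine Submodule.subset_span (Or.inl ⟨⟨i + k, i, i - r, by omega, by omega, h⟩, ?_⟩)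
      rw [even_of_ge _ _ (by simp)]
      simp [Nat.sub_sub_self hr]
    · rw [mul_assoc, ← ((G.commute_b.pow_left k).pow_right r).eq, ← mul_assoc,
        G.E_mul_ξ_pow_eq_zero (by omega), zero_mul]
      exact G.W.zero_mem
  · rw [G.E_mul_b_pow_eq_zero (by omega), zero_mul]
    exact G.W.zero_mem

/-- The cell has top `max i j + k`. Once this reaches `n`, the central factor `ξ^k` can be moved to
the end with the larger vertex, where it vanishes. -/
lemma b_ε_a_ξ_mem (i j k : ℕ) : G.b ^ i * G.ε * G.a ^ j * G.ξ ^ k ∈ G.W := by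
  by_cases h : max i j + k < n
  · refine Submodule.subset_span (Or.inr ⟨⟨max i j + k, i, j, by omega, by omega, h⟩, ?_⟩)
    simp [odd]
  · have h0 : G.b ^ i * G.ε * G.a ^ j * G.ξ ^ k = 0 := by
      rcases le_total i j with hij | hij
      · rw [mul_assoc (G.b ^ i), ← G.ε_mul_a_pow_mul_E, mul_assoc, mul_assoc,
          G.E_mul_ξ_pow_eq_zero (by omega), mul_zero, mul_zero]
      · rw [← G.E_mul_b_pow_mul_ε, mul_assoc, mul_assoc, mul_assoc,
          ← ((G.commute_a.pow_left k).pow_right j).eq, ← mul_assoc G.ε, ← (G.commute_ε.pow_left k).eq,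
          ← mul_assoc (G.b ^ i), ← mul_assoc (G.b ^ i),
          ← ((G.commute_b.pow_left k).pow_right i).eq, ← mul_assoc, ← mul_assoc, ← mul_assoc,
          G.E_mul_ξ_pow_eq_zero (by omega), zero_mul, zero_mul, zero_mul]
    rw [h0]
    exact G.W.zero_mem

/-- Allows closure properties to be checked on monomials with unrestricted exponents, without the
bounds that define cells. -/
lemma W_le {W' : Submodule K A} (h1 : ∀ i r k, G.E i * G.a ^ r * G.ξ ^ k ∈ W')
    (h2 : ∀ i r k, G.E i * G.b ^ r * G.ξ ^ k ∈ W')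
    (h3 : ∀ i j k, G.b ^ i * G.ε * G.a ^ j * G.ξ ^ k ∈ W') : G.W ≤ W' := by
  rw [W, Submodule.span_le]
  rintro _ (⟨c, rfl⟩ | ⟨c, rfl⟩)
  · rcases le_total c.row c.col with h | h
    · rw [even_of_le _ _ h]; exact h1 _ _ _
    · rw [even_of_ge _ _ h]; exact h2 _ _ _
  · exact h3 _ _ _

lemma one_mem : (1 : A) ∈ G.W := by
  rw [← G.sum_E]
  refine Submodule.sum_mem _ fun i _ => ?_
  simpa using G.E_a_ξ_mem i 0 0

lemma mul_E_mem {w : A} (hw : w ∈ G.W) (j : ℕ) : w * G.E j ∈ G.W := by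
  have hξ : ∀ k, G.ξ ^ k * G.E j = G.E j * G.ξ ^ k := fun k => ((G.commute_E j).pow_left k).eq
  refine (G.W_le (W' := G.W.comap (LinearMap.mulRight K (G.E j))) ?_ ?_ ?_) hw <;>
    intro i r k <;> rw [Submodule.mem_comap, LinearMap.mulRight_apply, mul_assoc, hξ, ← mul_assoc]
  · by_cases h : i + r = j
    · rw [← h, mul_assoc (G.E i), ← G.E_mul_a_pow, ← mul_assoc, G.E_mul_self]
      exact G.E_a_ξ_mem _ _ _
    · rw [G.E_mul_a_pow, mul_assoc (G.a ^ r), G.E_mul_of_ne _ _ h, mul_zero, zero_mul]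
      exact G.W.zero_mem
  · rw [mul_assoc (G.E i), G.b_pow_mul_E, ← mul_assoc]
    by_cases h : i = j + r
    · rw [← h, G.E_mul_self]
      exact G.E_b_ξ_mem _ _ _
    · rw [G.E_mul_of_ne _ _ h, zero_mul, zero_mul]
      exact G.W.zero_mem
  · by_cases h : r = j
    · rw [h, mul_assoc (G.b ^ i), mul_assoc (G.b ^ i), G.ε_mul_a_pow_mul_E, ← mul_assoc]
      exact G.b_ε_a_ξ_mem _ _ _
    · rw [mul_assoc (G.b ^ i), mul_assoc (G.b ^ i), ← G.ε_mul_a_pow_mul_E, mul_assoc (G.ε * _),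
        G.E_mul_of_ne _ _ h, mul_zero, mul_zero, zero_mul]
      exact G.W.zero_mem

lemma mul_a_mem {w : A} (hw : w ∈ G.W) : w * G.a ∈ G.W := by
  have hξ : ∀ k, G.ξ ^ k * G.a = G.a * G.ξ ^ k := fun k => (G.commute_a.pow_left k).eq
  refine (G.W_le (W' := G.W.comap (LinearMap.mulRight K G.a)) ?_ ?_ ?_) hw <;>
    intro i r k <;> rw [Submodule.mem_comap, LinearMap.mulRight_apply, mul_assoc, hξ, ← mul_assoc]
  · rw [mul_assoc (G.E i), ← pow_succ]
    exact G.E_a_ξ_mem _ _ _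
  · cases r with
    | zero => simpa using G.E_a_ξ_mem i 1 k
    | succ r =>
      -- The mesh relation replaces `b a` by `ξ - E 0 * ξ`; the correction term is right
      -- multiplication by `E 0`, already known to preserve `W`.
      have h1 : G.E i * G.b ^ (r + 1) * G.a * G.ξ ^ k =
          G.E i * G.b ^ r * G.ξ ^ (k + 1) - G.E i * G.b ^ r * G.ξ ^ (k + 1) * G.E 0 := by
        rw [mul_assoc _ _ (G.E 0), ((G.commute_E 0).pow_left _).eq, pow_succ, ← mul_assoc,
          mul_assoc _ G.b G.a, G.mesh, ← ξ, pow_succ']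
        noncomm_ring
      rw [h1]
      exact G.W.sub_mem (G.E_b_ξ_mem _ _ _) (G.mul_E_mem (G.E_b_ξ_mem _ _ _) 0)
  · rw [mul_assoc (G.b ^ i * G.ε), ← pow_succ]
    exact G.b_ε_a_ξ_mem _ _ _

lemma ε_mul_b : G.ε * G.b = 0 := by
  rw [← G.ε_mul_E, mul_assoc, G.E_zero_mul_b, mul_zero]

lemma mul_b_mem {w : A} (hw : w ∈ G.W) : w * G.b ∈ G.W := by
  have hξ : ∀ k, G.ξ ^ k * G.b = G.b * G.ξ ^ k := fun k => (G.commute_b.pow_left k).eq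
  refine (G.W_le (W' := G.W.comap (LinearMap.mulRight K G.b)) ?_ ?_ ?_) hw <;>
    intro i r k <;> rw [Submodule.mem_comap, LinearMap.mulRight_apply, mul_assoc, hξ, ← mul_assoc]
  · cases r with
    | zero => simpa using G.E_b_ξ_mem i 1 k
    | succ r =>
      rw [pow_succ, ← mul_assoc, mul_assoc _ G.a G.b, ← ξ, mul_assoc, ← pow_succ']
      exact G.E_a_ξ_mem _ _ _
  · rw [mul_assoc (G.E i), ← pow_succ]
    exact G.E_b_ξ_mem _ _ _
  · cases r with
    | zero =>
      rw [pow_zero, mul_one, mul_assoc (G.b ^ i), G.ε_mul_b, mul_zero, zero_mul]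
      exact G.W.zero_mem
    | succ r =>
      rw [pow_succ, ← mul_assoc, mul_assoc _ G.a G.b, ← ξ, mul_assoc, ← pow_succ']
      exact G.b_ε_a_ξ_mem _ _ _

/-- Translates between polynomials in `ε` and powers of `ξ` at the vertex `0`. The factor `E 0` is
needed for `m = 0`. -/
lemma E_zero_mul_pow (m : ℕ) :
    G.E 0 * (-(G.ε ^ 2 + G.ε ^ 3 * aeval G.ε p)) ^ m = G.E 0 * G.ξ ^ m := by
  rw [← G.deformed, ← ξ]
  induction m with
  | zero => simp
  | succ m ih =>
    rw [pow_succ, ← mul_assoc, ih, mul_assoc, ← mul_assoc (G.ξ ^ m),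
      ((G.commute_E 0).pow_left m).eq, mul_assoc, ← mul_assoc, G.E_mul_self, pow_succ]

lemma pow_mul_ε (m : ℕ) :
    (-(G.ε ^ 2 + G.ε ^ 3 * aeval G.ε p)) ^ m * G.ε = G.ξ ^ m * G.ε := by
  have h : ∀ z, G.ε * z = G.ε * (G.E 0 * z) := fun z => by rw [← mul_assoc, G.ε_mul_E]
  rw [← (G.ε_commute.pow_right m).eq, h, G.E_zero_mul_pow, ← h, (G.commute_ε.pow_left m).eq]

lemma mul_ε_mem {w : A} (hw : w ∈ G.W) : w * G.ε ∈ G.W := by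
  have hξ : ∀ k, G.ξ ^ k * G.ε = G.ε * G.ξ ^ k := fun k => (G.commute_ε.pow_left k).eq
  have haε : ∀ r, G.a ^ (r + 1) * G.ε = 0 := fun r => by
    rw [← G.E_mul_ε, ← mul_assoc, pow_succ, mul_assoc (G.a ^ r), G.a_mul_E_zero, mul_zero, zero_mul]
  have hb : ∀ i r k, G.E i * G.b ^ r * G.ε * G.ξ ^ k ∈ G.W := by
    intro i r k
    rw [mul_assoc (G.E i)]
    by_cases h : i = r
    · rw [h, G.E_mul_b_pow_mul_ε]
      simpa using G.b_ε_a_ξ_mem r 0 k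
    · rw [← G.E_mul_b_pow_mul_ε, ← mul_assoc, G.E_mul_of_ne _ _ h, zero_mul, zero_mul]
      exact G.W.zero_mem
  refine (G.W_le (W' := G.W.comap (LinearMap.mulRight K G.ε)) ?_ ?_ ?_) hw <;>
    intro i r k <;> rw [Submodule.mem_comap, LinearMap.mulRight_apply, mul_assoc, hξ, ← mul_assoc]
  · cases r with
    | zero => simpa using hb i 0 k
    | succ r =>
      rw [mul_assoc (G.E i), haε, mul_zero, zero_mul]
      exact G.W.zero_mem
  · exact hb i r k
  · cases r with
    | zero =>
      -- The only serious case is `b^i ε² ξ^k`. Expanding `ε²` in powers of `-(ε² + ε³ p(ε))` and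
      -- their products with `ε`, the map `F` turns each term into a monomial of `W`.
      let F : A →ₗ[K] A := LinearMap.mulRight K (G.ξ ^ k) ∘ₗ LinearMap.mulLeft K (G.b ^ i * G.E 0)
      have hF : ∀ z, F z = G.b ^ i * G.E 0 * z * G.ξ ^ k := fun z => rfl
      have h2 : G.b ^ i * G.ε * G.a ^ 0 * G.ε * G.ξ ^ k = F (G.ε ^ 2) := by
        rw [hF, pow_zero, mul_one, mul_assoc (G.b ^ i) (G.E 0), sq, ← mul_assoc (G.E 0), G.E_mul_ε,
          ← mul_assoc]
      rw [h2]
      refine (sup_le ?_ ?_ : _ ≤ G.W.comap F) (pow_mem_span_pow_mul p G.ε n G.nilp 2)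
      · rw [Submodule.span_le]
        rintro _ ⟨m, rfl⟩
        change F ((-(G.ε ^ 2 + G.ε ^ 3 * aeval G.ε p)) ^ m) ∈ G.W
        rw [hF, mul_assoc (G.b ^ i), G.E_zero_mul_pow, ← mul_assoc, mul_assoc _ (G.ξ ^ m),
          ← pow_add, G.b_pow_mul_E, zero_add]
        exact G.E_b_ξ_mem _ _ _
      · rw [Submodule.span_le]
        rintro _ ⟨m, rfl⟩
        change F ((-(G.ε ^ 2 + G.ε ^ 3 * aeval G.ε p)) ^ m * G.ε) ∈ G.W
        rw [hF, G.pow_mul_ε, hξ, mul_assoc (G.b ^ i), ← mul_assoc (G.E 0), G.E_mul_ε, ← mul_assoc,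
          mul_assoc _ (G.ξ ^ m), ← pow_add]
        simpa using G.b_ε_a_ξ_mem i 0 (m + k)
    | succ r =>
      rw [mul_assoc _ (G.a ^ (r + 1)), haε, mul_zero, zero_mul]
      exact G.W.zero_mem

end Gens
end TypeL

/-! ### Commutators of monomials -/

lemma mul_sub_mul_mem_commutatorSpace {K A : Type*} [CommRing K] [Ring A] [Algebra K A]
    (x y : A) : x * y - y * x ∈ commutatorSpace K A :=
  Submodule.subset_span ⟨x, y, rfl⟩

namespace TypeL
open Quiver PathAlgebra

namespace Gens

variable {K A : Type*} [Field K] [Ring A] [Algebra K A] {p : K[X]} {n : ℕ} (G : Gens K A p n)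

/-- The commutator of `E i * a` and `b * ξ^k` is `E i * ξ^{k+1} - E (i+1) * ξ^{k+1}`. These
differences telescope up to `E n = 0`. -/
lemma E_mul_ξ_pow_mem_commutatorSpace (i k : ℕ) :
    G.E i * G.ξ ^ (k + 1) ∈ commutatorSpace K A := by
  suffices H : ∀ m i, n ≤ i + m → G.E i * G.ξ ^ (k + 1) ∈ commutatorSpace K A from
    H n i (Nat.le_add_left _ _)
  intro m
  induction m with
  | zero =>
    intro i hi
    rw [G.E_eq_zero i hi, zero_mul]
    exact Submodule.zero_mem _
  | succ m ih =>
    intro i hi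
    have h1 := mul_sub_mul_mem_commutatorSpace (K := K) (G.E i * G.a) (G.b * G.ξ ^ k)
    have h2 : G.E i * G.a * (G.b * G.ξ ^ k) = G.E i * G.ξ ^ (k + 1) := by
      rw [mul_assoc, ← mul_assoc G.a, ← ξ, ← pow_succ']
    have h3 : G.b * G.ξ ^ k * (G.E i * G.a) = G.E (i + 1) * G.ξ ^ (k + 1) := by
      rw [mul_assoc, ← mul_assoc (G.ξ ^ k), ((G.commute_E i).pow_left k).eq, mul_assoc (G.E i),
        (G.commute_a.pow_left k).eq, ← mul_assoc, G.b_mul_E, mul_assoc, ← mul_assoc G.b, G.mesh,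
        sub_mul, mul_sub, ← mul_assoc, ← mul_assoc, ← mul_assoc, ← mul_assoc (G.E (i + 1)) (G.E 0),
        G.E_mul_of_ne _ _ (Nat.succ_ne_zero i), zero_mul, zero_mul, sub_zero,
        mul_assoc _ G.a, ← ξ, mul_assoc, ← pow_succ']
    rw [h2, h3] at h1
    simpa using Submodule.add_mem _ h1 (ih (i + 1) (by omega))

lemma even_mem_commutatorSpace (c : Cell n) (h : c.row = c.col) (ht : c.row < c.top) :
    G.even c ∈ commutatorSpace K A := by
  obtain ⟨k, hk⟩ : ∃ k, c.top - c.col = k + 1 := ⟨c.top - c.col - 1, by omega⟩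
  rw [G.even_of_le c h.le, h, Nat.sub_self, pow_zero, mul_one, hk]
  exact G.E_mul_ξ_pow_mem_commutatorSpace _ _

/-- With `i = c.row`, this is the commutator of `b^i ε a^{i+1} ξ^k` with `b`: one order gives `b^i ε
a^i ξ^{k+1}`, the other `b^{i+1} ε a^{i+1} ξ^k`. -/
lemma odd_sub_odd_mem_commutatorSpace (c d : Cell n) (hc : c.row = c.col) (hd : d.row = d.col)
    (htop : c.top = d.top) (h : d.row = c.row + 1) : G.odd c - G.odd d ∈ commutatorSpace K A := by
  have := d.row_le
  have h1 := mul_sub_mul_mem_commutatorSpace (K := K)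
    (G.b ^ c.row * G.ε * G.a ^ (c.row + 1) * G.ξ ^ (d.top - (c.row + 1))) G.b
  have h2 : G.b ^ c.row * G.ε * G.a ^ (c.row + 1) * G.ξ ^ (d.top - (c.row + 1)) * G.b = G.odd c := by
    rw [odd, ← hc, max_self, htop, mul_assoc _ _ G.b, (G.commute_b.pow_left _).eq, pow_succ,
      ← mul_assoc, mul_assoc _ _ G.b, mul_assoc _ G.a G.b, ← ξ, mul_assoc, mul_assoc _ G.ξ,
      ← pow_succ', show d.top - (c.row + 1) + 1 = d.top - c.row by omega, ← mul_assoc]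
  have h3 : G.b * (G.b ^ c.row * G.ε * G.a ^ (c.row + 1) * G.ξ ^ (d.top - (c.row + 1))) =
      G.odd d := by
    rw [odd, ← hd, max_self, h, pow_succ' G.b]
    simp only [mul_assoc]
  rwa [h2, h3] at h1

end Gens

/-! ### Generators of `L_n^p` and paths as signed monomials -/

variable (K : Type*) [Field K] (p : K[X]) {n : ℕ}

/-- The class of a path in `L_n^p`. -/
def cls {i j : Vertex n} (q : Path i j) : L K n p := proj K n p (ofPath K q)

lemma cls_comp {i j k : Vertex n} (q : Path i j) (r : Path j k) :
    cls K p (q.comp r) = cls K p q * cls K p r := by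
  rw [cls, cls, cls, ← map_mul, ofPath_mul_ofPath]

lemma cls_mul_of_ne {i j k l : Vertex n} (q : Path i j) (r : Path k l) (h : k ≠ j) :
    cls K p q * cls K p r = 0 := by
  rw [cls, cls, ← map_mul, ofPath_mul_ofPath_of_ne _ _ h, map_zero]

lemma cls_mem_commutatorSpace {i j : Vertex n} (q : Path i j) (h : i ≠ j) :
    cls K p q ∈ commutatorSpace K (L K n p) := by
  have h1 := mul_sub_mul_mem_commutatorSpace (K := K) (cls K p (Path.nil : Path i i)) (cls K p q)
  rwa [← cls_comp, Path.nil_comp, cls_mul_of_ne K p _ _ h, sub_zero] at h1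

variable (n)

/-- The idempotent of a vertex. -/
def idem (i : ℕ) : L K n p :=
  if h : i < n then cls K p (Path.nil : Path (⟨i, h⟩ : Vertex n) ⟨i, h⟩) else 0

/-- The class of `a_i`. -/
def clsA (i : ℕ) : L K n p := if h : i + 1 < n then cls K p (a i h) else 0

/-- The class of `(-1) ^ i ā_i`. -/
def clsB (i : ℕ) : L K n p := if h : i + 1 < n then (-1 : K) ^ i • cls K p (abar i h) else 0

lemma idem_mul_idem (i j : ℕ) : idem K p n i * idem K p n j = if i = j then idem K p n i else 0 := by
  unfold idem
  by_cases hi : i < n <;> by_cases hj : j < n <;> by_cases hij : i = j <;> simp only [hi, hj, hij,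
    dite_true, dite_false, if_true, if_false, mul_zero, zero_mul]
  · subst hij
    rw [← cls_comp, Path.nil_comp]
  · exact cls_mul_of_ne K p _ _ fun h => hij (congrArg Vertex.idx h).symm
  · omega

lemma idem_mul_clsA (i j : ℕ) : idem K p n i * clsA K p n j = if i = j then clsA K p n j else 0 := by
  unfold idem clsA
  by_cases hj : j + 1 < n
  · by_cases hij : i = j
    · subst hij
      rw [dif_pos hj, dif_pos (Nat.lt_of_succ_lt hj), if_pos rfl, ← cls_comp, Path.nil_comp]
    · rw [dif_pos hj, if_neg hij]
      split_ifs
      · exact cls_mul_of_ne K p _ _ fun h => hij (congrArg Vertex.idx h).symm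
      · rw [zero_mul]
  · rw [dif_neg hj, mul_zero, ite_self]

lemma clsA_mul_idem (i j : ℕ) :
    clsA K p n j * idem K p n i = if i = j + 1 then clsA K p n j else 0 := by
  unfold idem clsA
  by_cases hj : j + 1 < n
  · by_cases hij : i = j + 1
    · subst hij
      rw [dif_pos hj, dif_pos hj, if_pos rfl, ← cls_comp, Path.comp_nil]
    · rw [dif_pos hj, if_neg hij]
      split_ifs
      · exact cls_mul_of_ne K p _ _ fun h => hij (congrArg Vertex.idx h)
      · rw [mul_zero]
  · rw [dif_neg hj, zero_mul, ite_self]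

lemma idem_mul_clsB (i j : ℕ) :
    idem K p n i * clsB K p n j = if i = j + 1 then clsB K p n j else 0 := by
  unfold idem clsB
  by_cases hj : j + 1 < n
  · by_cases hij : i = j + 1
    · subst hij
      rw [dif_pos hj, dif_pos hj, if_pos rfl, mul_smul_comm, ← cls_comp, Path.nil_comp]
    · rw [dif_pos hj, if_neg hij]
      split_ifs
      · rw [mul_smul_comm, cls_mul_of_ne K p _ _ fun h => hij (congrArg Vertex.idx h).symm,
          smul_zero]
      · rw [zero_mul]
  · rw [dif_neg hj, mul_zero, ite_self]

lemma clsB_mul_idem (i j : ℕ) : clsB K p n j * idem K p n i = if i = j then clsB K p n j else 0 := by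
  unfold idem clsB
  by_cases hj : j + 1 < n
  · by_cases hij : i = j
    · subst hij
      rw [dif_pos hj, dif_pos (Nat.lt_of_succ_lt hj), if_pos rfl, smul_mul_assoc, ← cls_comp,
        Path.comp_nil]
    · rw [dif_pos hj, if_neg hij]
      split_ifs
      · rw [smul_mul_assoc, cls_mul_of_ne K p _ _ fun h => hij (congrArg Vertex.idx h), smul_zero]
      · rw [mul_zero]
  · rw [dif_neg hj, zero_mul, ite_self]

lemma sum_idem : ∑ i ∈ Finset.range n, idem K p n i = 1 := by
  rw [← map_one (proj K n p), one_def, map_sum, Finset.sum_range]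
  refine Fintype.sum_equiv
    { toFun := fun i => ⟨i.1, i.2⟩, invFun := fun i => ⟨i.1, i.2⟩, left_inv := fun _ => rfl,
      right_inv := fun _ => rfl } _ _ fun i => ?_
  rw [idem, dif_pos i.2]
  rfl

/-- The sum of the arrows `a_i`. -/
def sumA : L K n p := ∑ i ∈ Finset.range n, clsA K p n i

/-- The signed sum of the arrows `ā_i`. -/
def sumB : L K n p := ∑ i ∈ Finset.range n, clsB K p n i

lemma clsA_eq_zero {i : ℕ} (h : n ≤ i + 1) : clsA K p n i = 0 := dif_neg (by omega)

lemma clsB_eq_zero {i : ℕ} (h : n ≤ i + 1) : clsB K p n i = 0 := dif_neg (by omega)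

lemma idem_mul_sumA (i : ℕ) : idem K p n i * sumA K p n = clsA K p n i := by
  rw [sumA, Finset.mul_sum]
  simp only [idem_mul_clsA]
  rw [Finset.sum_ite_eq]
  split_ifs with h
  · rfl
  · rw [clsA_eq_zero]
    rw [Finset.mem_range] at h
    omega

lemma sumA_mul_idem (i : ℕ) : sumA K p n * idem K p n (i + 1) = clsA K p n i := by
  rw [sumA, Finset.sum_mul]
  simp only [clsA_mul_idem, add_left_inj]
  rw [Finset.sum_ite_eq]
  split_ifs with h
  · rfl
  · rw [clsA_eq_zero]
    rw [Finset.mem_range] at h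
    omega

lemma idem_mul_sumB (i : ℕ) : idem K p n (i + 1) * sumB K p n = clsB K p n i := by
  rw [sumB, Finset.mul_sum]
  simp only [idem_mul_clsB, add_left_inj]
  rw [Finset.sum_ite_eq]
  split_ifs with h
  · rfl
  · rw [clsB_eq_zero]
    rw [Finset.mem_range] at h
    omega

lemma sumB_mul_idem (i : ℕ) : sumB K p n * idem K p n i = clsB K p n i := by
  rw [sumB, Finset.sum_mul]
  simp only [clsB_mul_idem]
  rw [Finset.sum_ite_eq]
  split_ifs with h
  · rfl
  · rw [clsB_eq_zero]
    rw [Finset.mem_range] at h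
    omega

lemma clsA_mul_sumB (i : ℕ) : clsA K p n i * sumB K p n = clsA K p n i * clsB K p n i := by
  have h : clsA K p n i = clsA K p n i * idem K p n (i + 1) := by rw [clsA_mul_idem, if_pos rfl]
  rw [h, mul_assoc, idem_mul_sumB, mul_assoc, idem_mul_clsB, if_pos rfl]

lemma clsB_mul_sumA (i : ℕ) : clsB K p n i * sumA K p n = clsB K p n i * clsA K p n i := by
  have h : clsB K p n i = clsB K p n i * idem K p n i := by rw [clsB_mul_idem, if_pos rfl]
  rw [h, mul_assoc, idem_mul_sumA, mul_assoc, idem_mul_clsA, if_pos rfl]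

variable {n}

lemma proj_rel {r s : PathAlgebra K (Vertex n)} (h : Rel K n p r s) :
    proj K n p r = proj K n p s :=
  RingQuot.mkAlgHom_rel K h

/-- The alternating signs absorb the minus sign of the mesh relation. At the last vertex the default
value `0` of `clsA` and `clsB` makes the formula agree with `ā_{n-2} a_{n-2} = 0`. -/
lemma clsB_mul_clsA {i : ℕ} (hi : i + 1 < n) :
    clsB K p n i * clsA K p n i = clsA K p n (i + 1) * clsB K p n (i + 1) := by
  rw [clsA, clsB, dif_pos hi, dif_pos hi, smul_mul_assoc]
  by_cases h : i + 2 < n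
  · have h1 := proj_rel K p (Rel.mesh (p := p) i h)
    rw [map_add, map_mul, map_mul, map_zero] at h1
    change cls K p _ * cls K p _ + cls K p _ * cls K p _ = 0 at h1
    rw [clsA, clsB, dif_pos h, dif_pos h, mul_smul_comm, eq_neg_of_add_eq_zero_left h1, pow_succ]
    simp
  · have h1 := proj_rel K p (Rel.last (p := p) i hi (by omega))
    rw [map_mul, map_zero] at h1
    change cls K p _ * cls K p _ = 0 at h1
    rw [h1, smul_zero, clsA_eq_zero K p n (by omega), zero_mul]

/-- The standard generators of `L_n^p`. -/
def gens (hn : 0 + 1 < n) : Gens K (L K n p) p n where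
  E := idem K p n
  a := sumA K p n
  b := sumB K p n
  ε := cls K p (eps (Nat.lt_of_succ_lt hn))
  E_mul_self i := by rw [idem_mul_idem, if_pos rfl]
  E_mul_of_ne i j h := by rw [idem_mul_idem, if_neg h]
  E_eq_zero i h := dif_neg (by omega)
  sum_E := sum_idem K p n
  E_mul_a i := by rw [idem_mul_sumA, sumA_mul_idem]
  a_mul_E_zero := by
    rw [sumA, Finset.sum_mul]
    exact Finset.sum_eq_zero fun i _ => by rw [clsA_mul_idem, if_neg (Nat.succ_ne_zero i).symm]
  b_mul_E i := by rw [idem_mul_sumB, sumB_mul_idem]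
  E_zero_mul_b := by
    rw [sumB, Finset.mul_sum]
    exact Finset.sum_eq_zero fun i _ => by rw [idem_mul_clsB, if_neg (Nat.succ_ne_zero i).symm]
  ε_mul_E := by rw [idem, dif_pos (Nat.lt_of_succ_lt hn), ← cls_comp, Path.comp_nil]
  E_mul_ε := by rw [idem, dif_pos (Nat.lt_of_succ_lt hn), ← cls_comp, Path.nil_comp]
  mesh := by
    -- As the idempotents sum to `1`, the identity can be tested vertex by vertex. At vertex `0`
    -- both sides vanish.
    have key : ∀ x y : L K n p, (∀ i < n, idem K p n i * x = idem K p n i * y) → x = y := by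
      intro x y h
      rw [← one_mul x, ← one_mul y, ← sum_idem K p n, Finset.sum_mul, Finset.sum_mul]
      exact Finset.sum_congr rfl fun i hi => h i (Finset.mem_range.1 hi)
    refine key _ _ fun i hi => ?_
    cases i with
    | zero =>
      have h0 : idem K p n 0 * sumB K p n = 0 := by
        rw [sumB, Finset.mul_sum]
        exact Finset.sum_eq_zero fun i _ => by rw [idem_mul_clsB, if_neg (Nat.succ_ne_zero i).symm]
      rw [← mul_assoc, h0, zero_mul, mul_sub, ← mul_assoc (idem K p n 0) (idem K p n 0),
        idem_mul_idem, if_pos rfl, sub_self]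
    | succ i =>
      rw [← mul_assoc, idem_mul_sumB, clsB_mul_sumA, mul_sub,
        ← mul_assoc (idem K p n _) (idem K p n 0), idem_mul_idem, if_neg (Nat.succ_ne_zero i),
        zero_mul, sub_zero, ← mul_assoc, idem_mul_sumA, clsA_mul_sumB, clsB_mul_clsA K p hi]
  deformed := by
    have h1 := proj_rel K p (Rel.deformed (p := p) hn)
    rw [map_add, map_add, map_mul, map_mul, map_pow, map_pow, ← aeval_algHom_apply, map_zero] at h1
    change cls K p _ ^ 2 + cls K p _ * cls K p _ + cls K p _ ^ 3 * aeval (cls K p _) p = 0 at h1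
    rw [← mul_assoc, idem_mul_sumA, clsA_mul_sumB, clsA, clsB, dif_pos hn, dif_pos hn, pow_zero,
      one_smul, eq_neg_iff_add_eq_zero, ← h1]
    abel
  nilp := by
    have h1 := proj_rel K p (Rel.nilp (p := p) (Nat.lt_of_succ_lt hn))
    rw [map_pow, map_zero] at h1
    exact h1

variable (hn : 0 + 1 < n)

lemma cls_nil (i : ℕ) (hi : i < n) :
    cls K p (Path.nil : Path (⟨i, hi⟩ : Vertex n) ⟨i, hi⟩) = (gens K p hn).E i :=
  show _ = idem K p n i by rw [idem, dif_pos hi]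

lemma cls_a (i : ℕ) (hi : i + 1 < n) :
    cls K p (a i hi) = (gens K p hn).E i * (gens K p hn).a :=
  (dif_pos hi).symm.trans (idem_mul_sumA K p n i).symm

lemma cls_abar (i : ℕ) (hi : i + 1 < n) :
    cls K p (abar i hi) = (-1 : K) ^ i • ((gens K p hn).E (i + 1) * (gens K p hn).b) := by
  change _ = (-1 : K) ^ i • (idem K p n (i + 1) * sumB K p n)
  rw [idem_mul_sumB, clsB, dif_pos hi, smul_smul, ← mul_pow]
  simp

lemma cls_up (i j : ℕ) (hij : i ≤ j) (hj : j < n) :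
    cls K p (up i j hij hj) = (gens K p hn).E i * (gens K p hn).a ^ (j - i) := by
  induction j, hij using Nat.le_induction with
  | base => rw [up_self, cls_nil K p hn, Nat.sub_self, pow_zero, mul_one]
  | succ j hij ih =>
    rw [up_succ i j hij hj, cls_comp, ih, cls_a K p hn, Gens.E_mul_a_pow, mul_assoc,
      ← mul_assoc (Gens.E _ _), Nat.add_sub_cancel' hij, Gens.E_mul_self, Gens.E_mul_a, ← mul_assoc,
      ← pow_succ, show j - i + 1 = j + 1 - i by omega, Gens.E_mul_a_pow]
    congr 2
    omega

lemma cls_down (i j : ℕ) (hij : j ≤ i) (hi : i < n) :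
    cls K p (down i j hij hi) =
      sgn K i j • ((gens K p hn).E i * (gens K p hn).b ^ (i - j)) := by
  induction i, hij using Nat.le_induction with
  | base => rw [down_self, cls_nil K p hn, Nat.sub_self, pow_zero, mul_one, sgn_self, one_smul]
  | succ i hij ih =>
    rw [down_succ i j hij hi, cls_comp, ih, cls_abar K p hn, sgn_succ K hij, smul_mul_smul_comm,
      ← Gens.b_mul_E, mul_assoc, ← mul_assoc (Gens.E _ _), Gens.E_mul_self, ← mul_assoc,
      Gens.b_mul_E, mul_assoc, ← pow_succ', show i - j + 1 = i + 1 - j by omega]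

lemma cls_eps (h : 0 < n) : cls K p (eps h) = (gens K p hn).ε := rfl

lemma stdElt_even (c : Cell n) :
    stdElt K p n (.inl c) = sgn K c.top c.col • (gens K p hn).even c := by
  change cls K p ((up c.row c.top c.row_le c.top_lt).comp (down c.top c.col c.col_le c.top_lt)) = _
  rw [cls_comp, cls_up K p hn, cls_down K p hn, mul_smul_comm, Gens.even, ← mul_assoc,
    mul_assoc _ _ (Gens.E _ _)]
  have := (gens K p hn).E_mul_a_pow c.row (c.top - c.row)
  rw [Nat.add_sub_cancel' c.row_le] at this
  rw [← this, ← mul_assoc, Gens.E_mul_self]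

/-- The excursion up to the top and back contributes `ξ^{top - max}`, which is central and can be
moved to the right end. -/
lemma stdElt_odd (c : Cell n) :
    stdElt K p n (.inr c) = oddSgn K c • (gens K p hn).odd c := by
  have hr := c.row_le
  have hc := c.col_le
  set G := gens K p hn with hG
  have hεa : ∀ j z, G.ε * (G.E 0 * z) = G.ε * z ∧ G.a ^ j * (G.E j * z) = G.E 0 * (G.a ^ j * z) := by
    intro j z
    have h := G.E_mul_a_pow 0 j
    rw [zero_add] at h
    exact ⟨by rw [← mul_assoc, G.ε_mul_E], by rw [← mul_assoc, ← h, mul_assoc]⟩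
  change proj K n p (ofTotal K (oddPath c)) = _
  rw [oddPath, oddSgn]
  split_ifs with h
  · change cls K p ((((down c.row 0 (Nat.zero_le _) c.row_lt).comp
      (eps (Nat.zero_lt_of_lt c.top_lt))).comp
      (up 0 c.top (Nat.zero_le _) c.top_lt)).comp (down c.top c.col c.col_le c.top_lt)) = _
    rw [cls_comp, cls_comp, cls_comp, cls_up K p hn, cls_down K p hn, cls_down K p hn,
      cls_eps K p hn, ← hG, smul_mul_assoc, smul_mul_assoc, smul_mul_smul_comm, Gens.odd,
      max_eq_right h.le]
    congr 1
    simp only [mul_assoc, Nat.sub_zero]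
    rw [(hεa c.top _).2, (hεa 0 _).1, (hεa 0 _).1]
    have h1 : G.a ^ c.top * G.b ^ (c.top - c.col) = G.a ^ c.col * G.ξ ^ (c.top - c.col) := by
      rw [← G.a_pow_mul_b_pow, ← mul_assoc, ← pow_add, Nat.add_sub_cancel' hc]
    rw [h1, ← mul_assoc (G.b ^ c.row), ← mul_assoc (G.E c.row), G.E_mul_b_pow_mul_ε, mul_assoc]
  · change cls K p ((((up c.row c.top c.row_le c.top_lt).comp
      (down c.top 0 (Nat.zero_le _) c.top_lt)).comp (eps (Nat.zero_lt_of_lt c.top_lt))).comp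
      (up 0 c.col (Nat.zero_le _) c.col_lt)) = _
    rw [cls_comp, cls_comp, cls_comp, cls_up K p hn, cls_down K p hn, cls_up K p hn,
      cls_eps K p hn, ← hG, mul_smul_comm, smul_mul_assoc, smul_mul_assoc, Gens.odd,
      max_eq_left (by omega)]
    congr 1
    have h2 := G.E_mul_a_pow c.row (c.top - c.row)
    rw [Nat.add_sub_cancel' hr] at h2
    have h1 : G.E c.row * G.a ^ (c.top - c.row) * (G.E c.top * G.b ^ c.top) =
        G.E c.row * (G.ξ ^ (c.top - c.row) * G.b ^ c.row) := by
      rw [mul_assoc, ← mul_assoc (G.a ^ _) (G.E _), ← h2, ← mul_assoc, ← mul_assoc, G.E_mul_self,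
        ← G.a_pow_mul_b_pow, mul_assoc, mul_assoc, ← pow_add, Nat.sub_add_cancel hr]
    have h3 : Commute (G.ξ ^ (c.top - c.row)) (G.b ^ c.row * G.ε * G.a ^ c.col) :=
      (((G.commute_b.pow_right _).mul_right G.commute_ε).mul_right
        (G.commute_a.pow_right _)).pow_left _
    rw [Nat.sub_zero, Nat.sub_zero, h1]
    calc G.E c.row * (G.ξ ^ (c.top - c.row) * G.b ^ c.row) * G.ε * (G.E 0 * G.a ^ c.col)
        = G.E c.row * G.ξ ^ (c.top - c.row) * G.b ^ c.row * (G.ε * G.a ^ c.col) := by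
          rw [mul_assoc _ G.ε, (hεa 0 _).1, ← mul_assoc (G.E _)]
      _ = G.ξ ^ (c.top - c.row) * (G.E c.row * (G.b ^ c.row * G.ε) * G.a ^ c.col) := by
          rw [← ((G.commute_E c.row).pow_left _).eq]
          simp only [mul_assoc]
      _ = G.b ^ c.row * G.ε * G.a ^ c.col * G.ξ ^ (c.top - c.row) := by
          rw [G.E_mul_b_pow_mul_ε, h3.eq]

end TypeL

/-! ### The centre of a symmetric algebra -/

section SymmetricForm

variable {K A : Type*} [Field K] [Ring A] [Algebra K A] [FiniteDimensional K A]

/-- In a finite-dimensional algebra with a nondegenerate symmetric trace form, the centre is the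
orthogonal complement of the commutator space. -/
lemma finrank_center_of_symmetric (φ : A →ₗ[K] K) (hφ : ∀ u v, φ (u * v) = φ (v * u))
    (hnd : ∀ u, (∀ v, φ (u * v) = 0) → u = 0) :
    Module.finrank K (Subalgebra.center K A) =
      Module.finrank K A - Module.finrank K (commutatorSpace K A) := by
  let B : LinearMap.BilinForm K A := (LinearMap.mul K A).compr₂ φ
  have hB : ∀ u v, B u v = φ (u * v) := fun u v => rfl
  have hBnd : B.Nondegenerate :=
    ⟨hnd, fun v h => hnd v fun u => (hφ v u).trans (h u)⟩
  rw [← LinearMap.BilinForm.finrank_orthogonal hBnd]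
  have hc : Subalgebra.toSubmodule (Subalgebra.center K A) =
      B.orthogonal (commutatorSpace K A) := by
    ext z
    -- Thus `z` is orthogonal to all commutators exactly when each `b z - z b` is orthogonal to
    -- everything, that is, when it is zero.
    have key : ∀ a b : A, φ ((a * b - b * a) * z) = φ ((b * z - z * b) * a) := by
      intro a b
      rw [sub_mul, sub_mul, map_sub, map_sub, mul_assoc a, hφ a, mul_assoc b a z, hφ b (a * z),
        mul_assoc a z b, hφ a (z * b)]
    rw [Subalgebra.mem_toSubmodule, Subalgebra.mem_center_iff, LinearMap.BilinForm.mem_orthogonal_iff]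
    constructor
    · intro hz c hc
      rw [hB]
      refine Submodule.span_induction (p := fun c _ => φ (c * z) = 0) ?_ ?_ ?_ ?_ hc
      · rintro _ ⟨a, b, rfl⟩
        rw [key, hz, sub_self, zero_mul, map_zero]
      · rw [zero_mul, map_zero]
      · intro x y _ _ hx hy
        rw [add_mul, map_add, hx, hy, add_zero]
      · intro k x _ hx
        rw [smul_mul_assoc, map_smul, hx, smul_zero]
    · intro h b
      refine sub_eq_zero.1 (hnd _ fun a => ?_)
      rw [← key]
      exact h _ (mul_sub_mul_mem_commutatorSpace a b)
  rw [← hc]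
  rfl

end SymmetricForm

/-! ### Spanning sets of the algebra and of its commutator quotient -/

namespace TypeL
open Quiver PathAlgebra

variable (K : Type*) [Field K] (p : K[X]) {n : ℕ}

section Spanning

variable (hn : 0 + 1 < n)

lemma gens_W_eq_top : (gens K p hn).W = ⊤ := by
  set G := gens K p hn with hG
  have hpath : ∀ {i j : Vertex n} (q : Path i j) (w : L K n p), w ∈ G.W → w * cls K p q ∈ G.W := by
    intro i j q w hw
    induction q with
    | nil => rw [cls_nil K p hn]; exact G.mul_E_mem hw _
    | cons q f ih =>
      change w * cls K p (q.comp f.toPath) ∈ G.W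
      rw [cls_comp, ← mul_assoc]
      change Arrow n _ _ at f
      cases f with
      | eps h => exact G.mul_ε_mem ih
      | a m h =>
        change _ * cls K p (a m h) ∈ G.W
        rw [cls_a K p hn, ← mul_assoc]
        exact G.mul_a_mem (G.mul_E_mem ih _)
      | abar m h =>
        change _ * cls K p (abar m h) ∈ G.W
        rw [cls_abar K p hn, mul_smul_comm, ← mul_assoc]
        exact G.W.smul_mem _ (G.mul_b_mem (G.mul_E_mem ih _))
  rw [eq_top_iff]
  rintro z -
  obtain ⟨z, rfl⟩ := RingQuot.mkAlgHom_surjective K (Rel K n p) z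
  change proj K n p z ∈ G.W
  induction z using induction_paths with
  | path x =>
    have := hpath x.2.2 1 G.one_mem
    rwa [one_mul] at this
  | zero => rw [map_zero]; exact G.W.zero_mem
  | add x y hx hy => rw [map_add]; exact G.W.add_mem hx hy
  | smul c x hx => rw [map_smul]; exact G.W.smul_mem c hx

lemma even_mem_of_stdElt {S : Submodule K (L K n p)} {c : Cell n}
    (h : stdElt K p n (.inl c) ∈ S) : (gens K p hn).even c ∈ S := by
  rw [stdElt_even K p hn] at h
  exact (S.smul_mem_iff (sgn_ne_zero K _ _)).1 h

lemma odd_mem_of_stdElt {S : Submodule K (L K n p)} {c : Cell n}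
    (h : stdElt K p n (.inr c) ∈ S) : (gens K p hn).odd c ∈ S := by
  rw [stdElt_odd K p hn] at h
  exact (S.smul_mem_iff (oddSgn_ne_zero K _)).1 h

include hn in
lemma top_le_span_stdElt : ⊤ ≤ Submodule.span K (Set.range (stdElt K p n)) := by
  rw [← gens_W_eq_top K p hn, Gens.W, Submodule.span_le]
  rintro _ (⟨c, rfl⟩ | ⟨c, rfl⟩)
  · exact even_mem_of_stdElt K p hn (Submodule.subset_span ⟨_, rfl⟩)
  · exact odd_mem_of_stdElt K p hn (Submodule.subset_span ⟨_, rfl⟩)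

end Spanning

variable (n) in
/-- The characters of `L_n^p` that read off the coefficients of the trivial paths. -/
def trivialRep : Rep (Vertex n) (Vertex n → K) where
  e i := Pi.single i 1
  w _ := 0
  e_mul_self i := by rw [← Pi.single_mul, one_mul]
  e_mul_of_ne i j h := by
    funext k
    by_cases hk : k = i
    · subst hk; simp [h]
    · simp [hk]
  sum_e := Finset.univ_sum_single 1
  e_mul_w _ := mul_zero _
  w_mul_e _ := zero_mul _

/-- No relation has a trivial path as a term, so all arrows may be sent to zero. The target is
commutative, so these characters kill commutators. -/
lemma exists_character : ∃ χ : L K n p →ₐ[K] (Vertex n → K),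
    (∀ i : Vertex n, χ (cls K p (Path.nil : Path i i)) = Pi.single i 1) ∧
    ∀ h : 0 < n, χ (cls K p (eps h)) = 0 := by
  have hF : ∀ {i j : Vertex n} (q : Path i j), (trivialRep K n).lift K (ofPath K q) =
    (trivialRep K n).val q := Rep.lift_ofPath _
  have h0 : ∀ {i j : Vertex n} (f : Arrow n i j), (trivialRep K n).val (Hom.toPath (V := Vertex n) f) = 0 :=
    fun {i j} f => (Rep.val_toPath (trivialRep K n) (i := i) (j := j) f).trans rfl
  let χ : L K n p →ₐ[K] (Vertex n → K) := RingQuot.liftAlgHom K ⟨(trivialRep K n).lift K, by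
    intro r s h
    cases h with
    | mesh i h => simp [hF, a, abar, h0]
    | last i h hi => simp [hF, a, abar, h0]
    | nilp h => rw [map_pow, map_zero, hF, eps, h0, zero_pow (by omega)]
    | deformed h => simp [hF, a, abar, eps, h0]⟩
  have hχ : ∀ {i j : Vertex n} (q : Path i j), χ (cls K p q) = (trivialRep K n).val q := fun q =>
    (RingQuot.liftAlgHom_mkAlgHom_apply K _ _ _).trans (hF q)
  exact ⟨χ, fun i => hχ _, fun h => (hχ _).trans (h0 _)⟩

/-- The representatives `e_0, …, e_{n-1}, ε, ε³, …, ε^{2n-1}`. -/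
def quotElt (hn : 0 + 1 < n) : Fin n ⊕ Fin n → L K n p :=
  Sum.elim (fun i => cls K p (Path.nil : Path (⟨i, i.2⟩ : Vertex n) ⟨i, i.2⟩))
    fun l => cls K p (eps (Nat.lt_of_succ_lt hn)) ^ (2 * (l : ℕ) + 1)

section Commutators

variable (hn : 0 + 1 < n)

lemma stdElt_inl (c : Cell n) : stdElt K p n (.inl c) = proj K n p (ofTotal K (evenPath c)) := rfl

lemma stdElt_inr (c : Cell n) : stdElt K p n (.inr c) = proj K n p (ofTotal K (oddPath c)) := rfl

/-- The span of the proposed basis elements of the commutator space. -/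
def commSpan (K : Type*) [Field K] (p : K[X]) (n : ℕ) : Submodule K (L K n p) :=
  Submodule.span K (Set.range fun x : {x // IsCommutatorBasisElt K n x} => proj K n p x.1)

variable {K} in
lemma proj_mem_commSpan {x : PathAlgebra K (Vertex n)} (hx : IsCommutatorBasisElt K n x) :
    proj K n p x ∈ commSpan K p n := Submodule.subset_span ⟨⟨x, hx⟩, rfl⟩

lemma even_closed_mem_commSpan (c : Cell n) (h : c.row = c.col) (ht : c.row < c.top) :
    stdElt K p n (.inl c) ∈ commSpan K p n := by
  rw [stdElt_inl]
  by_cases h0 : c.row = 0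
  · obtain ⟨m, i, j, hi, hj, hm⟩ := c
    simp only at h h0 ht
    subst h h0
    obtain ⟨l, rfl⟩ : ∃ l, m = l + 1 := ⟨m - 1, by omega⟩
    exact proj_mem_commSpan p (IsCommutatorBasisElt.zeroClosed l hm)
  · refine proj_mem_commSpan p (IsCommutatorBasisElt.evenClosed _ (isStandard_evenPath c)
      (Vertex.ext h) ?_ ?_ h0)
    · rw [length_evenPath, h]
      exact ⟨_, rfl⟩
    · rw [length_evenPath]
      omega

include hn in
lemma commSpan_le : commSpan K p n ≤ commutatorSpace K (L K n p) := by
  rw [commSpan, Submodule.span_le]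
  have hev : ∀ c : Cell n, c.row = c.col → c.row < c.top →
      stdElt K p n (.inl c) ∈ commutatorSpace K (L K n p) := fun c h ht => by
    rw [stdElt_even K p hn]
    exact Submodule.smul_mem _ _ (Gens.even_mem_commutatorSpace _ c h ht)
  rintro _ ⟨⟨x, hx⟩, rfl⟩
  simp only [SetLike.mem_coe]
  cases hx with
  | nonclosed x hx h => exact cls_mem_commutatorSpace K p x.2.2 h
  | evenClosed x hx hc heven hlen h0 =>
    obtain ⟨c | c, rfl⟩ := exists_std_eq hx
    · have h : c.row = c.col := congrArg Vertex.idx hc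
      refine hev c h ?_
      change 2 ≤ (evenPath c).length at hlen
      rw [length_evenPath] at hlen
      omega
    · have h : c.row = c.col := by
        change (oddPath c).source = (oddPath c).target at hc
        rw [oddPath_source, oddPath_target] at hc
        exact congrArg Vertex.idx hc
      change Even (oddPath c).length at heven
      rw [length_oddPath c h] at heven
      exact absurd heven (Nat.not_even_iff_odd.2 ⟨_, rfl⟩)
  | oddDiff x y hx hy hcx hcy hlen hodd hcons =>
    obtain ⟨c | c, rfl⟩ := exists_std_eq hx
    · have h : c.row = c.col := congrArg Vertex.idx hcx
      change Odd (evenPath c).length at hodd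
      rw [length_evenPath, h] at hodd
      exact absurd ⟨_, rfl⟩ (Nat.not_even_iff_odd.2 hodd)
    · obtain ⟨d | d, rfl⟩ := exists_std_eq hy
      · have h : d.row = d.col := congrArg Vertex.idx hcy
        rw [hlen] at hodd
        change Odd (evenPath d).length at hodd
        rw [length_evenPath, h] at hodd
        exact absurd ⟨_, rfl⟩ (Nat.not_even_iff_odd.2 hodd)
      · change (oddPath c).source = (oddPath c).target at hcx
        change (oddPath d).source = (oddPath d).target at hcy
        change (oddPath d).source.idx = (oddPath c).source.idx + 1 at hcons
        change (oddPath c).length = (oddPath d).length at hlen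
        rw [oddPath_source, oddPath_target] at hcx hcy
        rw [oddPath_source, oddPath_source] at hcons
        have hc : c.row = c.col := congrArg Vertex.idx hcx
        have hd : d.row = d.col := congrArg Vertex.idx hcy
        rw [length_oddPath c hc, length_oddPath d hd] at hlen
        rw [map_sub]
        change stdElt K p n (.inr c) - stdElt K p n (.inr d) ∈ _
        have htop : c.top = d.top := by omega
        -- For closed paths the sign depends only on the top, hence only on the length; the plain
        -- difference of paths is therefore a multiple of the normalized one.
        have hs : oddSgn K c = oddSgn K d := by
          rw [oddSgn, oddSgn, if_neg (by omega), if_neg (by omega), htop]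
        rw [stdElt_odd K p hn, stdElt_odd K p hn, hs, ← smul_sub]
        exact Submodule.smul_mem _ _
          (Gens.odd_sub_odd_mem_commutatorSpace _ c d hc hd htop hcons)
  | zeroClosed l hl => exact hev ⟨l + 1, 0, 0, by omega, by omega, hl⟩ rfl (Nat.succ_pos l)

/-- All powers of `ε` lie in the sum: odd ones are representatives or zero, and even ones are
reduced by leading terms to elements `e_0 ξ^m` and higher powers. This settles the odd closed paths
at `0`; consecutive differences carry them to the other vertices. -/
lemma commSpan_sup_eq_top :
    commSpan K p n ⊔ Submodule.span K (Set.range (quotElt K p hn)) = ⊤ := by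
  set U := commSpan K p n ⊔ Submodule.span K (Set.range (quotElt K p hn)) with hU
  set G := gens K p hn with hG
  have hS : ∀ z ∈ commSpan K p n, z ∈ U := fun z hz => Submodule.mem_sup_left hz
  have hD : ∀ q, quotElt K p hn q ∈ U := fun q =>
    Submodule.mem_sup_right (Submodule.subset_span ⟨q, rfl⟩)
  have hE : ∀ i, G.E i ∈ U := by
    intro i
    by_cases h : i < n
    · rw [hG, ← cls_nil K p hn i h]
      exact hD (.inl ⟨i, h⟩)
    · rw [G.E_eq_zero i (by omega)]
      exact U.zero_mem
  -- For `m = 0` this is `1`, the sum of the trivial paths. For `m > 0` the power equals `E 0 *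
  -- ξ^m`, an even closed path at `0` up to sign, or zero.
  have hx : ∀ m, (-(G.ε ^ 2 + G.ε ^ 3 * aeval G.ε p)) ^ m ∈ U := by
    intro m
    rcases m with _ | m
    · rw [pow_zero, ← G.sum_E]
      exact U.sum_mem fun i _ => hE i
    · have h1 : G.E 0 * (-(G.ε ^ 2 + G.ε ^ 3 * aeval G.ε p)) =
          -(G.ε ^ 2 + G.ε ^ 3 * aeval G.ε p) := by
        rw [← G.deformed, ← mul_assoc, G.E_mul_self]
      have h2 := G.E_zero_mul_pow (m + 1)
      rw [pow_succ', ← mul_assoc, h1] at h2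
      rw [pow_succ', h2]
      by_cases hm : m + 1 < n
      · have h3 := even_closed_mem_commSpan K p (⟨m + 1, 0, 0, by omega, by omega, hm⟩ : Cell n) rfl
          (Nat.succ_pos m)
        have h4 := even_mem_of_stdElt K p hn h3
        rw [G.even_of_le _ le_rfl] at h4
        simp only [Nat.sub_self, Nat.sub_zero, pow_zero, mul_one] at h4
        exact hS _ h4
      · rw [G.E_mul_ξ_pow_eq_zero (by omega)]
        exact U.zero_mem
  have hpow : ∀ d, G.ε ^ d ∈ U := by
    intro d
    refine (sup_le ?_ ?_ : _ ≤ U) (pow_mem_span_pow_odd p G.ε n G.nilp d)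
    · rw [Submodule.span_le]
      rintro _ ⟨m, rfl⟩
      exact hx m
    · rw [Submodule.span_le]
      rintro _ ⟨l, rfl⟩
      exact hD (.inr l)
  have hε : ∀ f : K[X], aeval G.ε f ∈ U := by
    intro f
    rw [aeval_eq_sum_range]
    exact U.sum_mem fun i _ => U.smul_mem _ (hpow i)
  have hodd : ∀ (i m : ℕ) (hi : i ≤ m) (hm : m < n),
      stdElt K p n (.inr ⟨m, i, i, hi, hi, hm⟩) ∈ U := by
    intro i
    induction i with
    | zero =>
      intro m _ hm
      rw [stdElt_odd K p hn]
      refine U.smul_mem _ ?_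
      rw [← hG, Gens.odd]
      simp only [max_self, Nat.sub_zero, pow_zero, one_mul, mul_one]
      rw [← (G.commute_ε.pow_left m).eq, ← G.pow_mul_ε]
      have h1 := hε ((-(X ^ 2 + X ^ 3 * p)) ^ m * X)
      rwa [map_mul, map_pow, map_neg, map_add, map_mul, map_pow, map_pow, aeval_X] at h1
    | succ i ih =>
      intro m hi hm
      have h1 := ih m (by omega) hm
      have h2 : stdElt K p n (.inr ⟨m, i, i, by omega, by omega, hm⟩) -
          stdElt K p n (.inr ⟨m, i + 1, i + 1, hi, hi, hm⟩) ∈ U := by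
        rw [stdElt_inr, stdElt_inr, ← map_sub]
        refine hS _ (proj_mem_commSpan p (IsCommutatorBasisElt.oddDiff _ _ (isStandard_oddPath _)
          (isStandard_oddPath _) ?_ ?_ ?_ ?_ ?_))
        · rw [oddPath_source, oddPath_target]; rfl
        · rw [oddPath_source, oddPath_target]; rfl
        · rw [length_oddPath _ rfl, length_oddPath _ rfl]
        · rw [length_oddPath _ rfl]
          exact ⟨_, rfl⟩
        · rw [oddPath_source, oddPath_source]; rfl
      have h3 := U.sub_mem h1 h2
      rwa [sub_sub_cancel] at h3
  rw [eq_top_iff]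
  refine (top_le_span_stdElt K p hn).trans ?_
  rw [Submodule.span_le]
  rintro _ ⟨c | c, rfl⟩
  · by_cases h : c.row = c.col
    · by_cases ht : c.row < c.top
      · exact hS _ (even_closed_mem_commSpan K p c h ht)
      · rw [stdElt_even K p hn]
        have h1 := c.row_le
        refine U.smul_mem _ ?_
        rw [Gens.even, show c.top - c.row = 0 by omega, show c.top - c.col = 0 by omega, pow_zero,
          mul_one, pow_zero, mul_one]
        exact hE _
    · exact hS _ (proj_mem_commSpan p (IsCommutatorBasisElt.nonclosed _ (isStandard_evenPath c)
        fun he => h (congrArg Vertex.idx he)))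
  · by_cases h : c.row = c.col
    · obtain ⟨m, i, j, hi, hj, hm⟩ := c
      simp only at h
      subst h
      exact hodd _ _ hi hm
    · refine hS _ (proj_mem_commSpan p (IsCommutatorBasisElt.nonclosed _ (isStandard_oddPath c) ?_))
      change (oddPath c).source ≠ (oddPath c).target
      rw [oddPath_source, oddPath_target]
      exact fun he => h (congrArg Vertex.idx he)

end Commutators

/-! ### Counting the proposed basis of the commutator space -/

section Counting

/-- The proposed basis element of the commutator space attached to a cell. -/
def commElt : Cell n ⊕ Cell n → PathAlgebra K (Vertex n) :=
  Sum.elim (fun c => ofTotal K (evenPath c)) fun c =>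
    if c.row = c.col then
      -- A difference is indexed by its second path, whose predecessor is determined by length and
      -- vertex. For `row = 0` the truncated subtraction gives the value `0`; these cells are
      -- excluded.
      ofTotal K (oddPath ⟨c.top, c.row - 1, c.row - 1, (Nat.sub_le _ _).trans c.row_le,
        (Nat.sub_le _ _).trans c.row_le, c.top_lt⟩) - ofTotal K (oddPath c)
    else ofTotal K (oddPath c)

/-- The indices of the trivial paths and of the odd closed paths at the vertex `0`. -/
def IsExcluded : Cell n ⊕ Cell n → Prop :=
  Sum.elim (fun c => c.row = c.top ∧ c.col = c.top) fun c => c.row = 0 ∧ c.col = 0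

lemma exists_commElt_eq {x : PathAlgebra K (Vertex n)} (hx : IsCommutatorBasisElt K n x) :
    ∃ q, ¬ IsExcluded q ∧ commElt K q = x := by
  have hl : ∀ c : Cell n, (std (.inl c) : TotalPath (Vertex n)).length =
    (c.top - c.row) + (c.top - c.col) := length_evenPath
  have hr : ∀ c : Cell n, c.row = c.col → (std (.inr c) : TotalPath (Vertex n)).length =
    2 * c.top + 1 := length_oddPath
  have hls : ∀ c : Cell n, (std (.inl c)).source = (std (.inl c)).target → c.row = c.col :=
    fun c h => congrArg Vertex.idx h
  have hsrc : ∀ c : Cell n, (std (.inr c)).source.idx = c.row := fun c =>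
    congrArg Vertex.idx (oddPath_source c)
  have htgt : ∀ c : Cell n, (std (.inr c)).target.idx = c.col := fun c =>
    congrArg Vertex.idx (oddPath_target c)
  have hrs : ∀ c : Cell n, (std (.inr c)).source = (std (.inr c)).target ↔ c.row = c.col := by
    intro c
    rw [Vertex.ext_iff, hsrc, htgt]
  cases hx with
  | nonclosed x hx h =>
    obtain ⟨c | c, rfl⟩ := exists_std_eq hx
    · exact ⟨.inl c, fun he => h (Vertex.ext (he.1.trans he.2.symm)), rfl⟩
    · rw [Ne, hrs] at h
      exact ⟨.inr c, fun he => h (he.1.trans he.2.symm), if_neg h⟩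
  | evenClosed x hx hc heven hlen h0 =>
    obtain ⟨c | c, rfl⟩ := exists_std_eq hx
    · refine ⟨.inl c, fun he => ?_, rfl⟩
      rw [hl, he.1, he.2] at hlen
      omega
    · rw [hr c ((hrs c).1 hc)] at heven
      exact absurd heven (Nat.not_even_iff_odd.2 ⟨_, rfl⟩)
  | oddDiff x y hx hy hcx hcy hlen hodd hcons =>
    obtain ⟨d | d, rfl⟩ := exists_std_eq hy
    · rw [hlen, hl, hls d hcy] at hodd
      exact absurd ⟨_, rfl⟩ (Nat.not_even_iff_odd.2 hodd)
    · obtain ⟨c | c, rfl⟩ := exists_std_eq hx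
      · rw [hl, hls c hcx] at hodd
        exact absurd ⟨_, rfl⟩ (Nat.not_even_iff_odd.2 hodd)
      · have hc := (hrs c).1 hcx
        have hd := (hrs d).1 hcy
        rw [hr c hc, hr d hd] at hlen
        rw [hsrc, hsrc] at hcons
        refine ⟨.inr d, fun he => ?_, ?_⟩
        · have := he.1
          omega
        · change (if d.row = d.col then _ else _) = _
          rw [if_pos hd]
          change _ = ofTotal K (oddPath c) - ofTotal K (oddPath d)
          congr 3
          ext <;> simp only <;> omega
  | zeroClosed l hl =>
    exact ⟨.inl ⟨l + 1, 0, 0, by omega, by omega, hl⟩, fun he => Nat.succ_ne_zero l he.1.symm, rfl⟩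

instance : Finite {x // IsCommutatorBasisElt K n x} := by
  refine Set.Finite.to_subtype (s := {x | IsCommutatorBasisElt K n x})
    ((Set.finite_range (commElt K (n := n))).subset fun x hx => ?_)
  obtain ⟨q, -, rfl⟩ := exists_commElt_eq K hx
  exact ⟨q, rfl⟩

/-- The listed elements are values of `commElt` at cells that are not excluded, and at least `2n`
cells are excluded: `n` trivial paths and `n` odd closed paths at `0`. Injectivity of `commElt` is
not needed. -/
lemma card_commElt_add_le :
    Nat.card {x // IsCommutatorBasisElt K n x} + 2 * n ≤ 2 * Fintype.card (Cell n) := by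
  classical
  have h1 : Nat.card {x // IsCommutatorBasisElt K n x} ≤
      (Finset.univ.filter fun q : Cell n ⊕ Cell n => ¬ IsExcluded q).card := by
    have hsub : {x | IsCommutatorBasisElt K n x} ⊆ ((Finset.univ.filter
        fun q : Cell n ⊕ Cell n => ¬ IsExcluded q).image (commElt K) : Finset _) := by
      intro x hx
      obtain ⟨q, hq, rfl⟩ := exists_commElt_eq K hx
      exact Finset.mem_coe.2 (Finset.mem_image_of_mem _ (by simpa using hq))
    have h2 := Set.ncard_le_ncard hsub (Finset.finite_toSet _)
    rw [Set.ncard_coe_finset] at h2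
    exact h2.trans Finset.card_image_le
  have h2 : 2 * n ≤ (Finset.univ.filter fun q : Cell n ⊕ Cell n => IsExcluded q).card := by
    let f : Fin n ⊕ Fin n → Cell n ⊕ Cell n :=
      Sum.map (fun i => ⟨i, i, i, le_rfl, le_rfl, i.2⟩)
        fun i => ⟨i, 0, 0, Nat.zero_le _, Nat.zero_le _, i.2⟩
    have hf : Function.Injective f :=
      Function.Injective.sumMap (fun i j h => Fin.ext (congrArg Cell.top h))
        (fun i j h => Fin.ext (congrArg Cell.top h))
    have h3 := Finset.card_le_card_of_injOn (s := Finset.univ)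
      (t := Finset.univ.filter fun q : Cell n ⊕ Cell n => IsExcluded q) f (by
        intro q _
        rcases q with i | i <;>
          exact Finset.mem_coe.2 (Finset.mem_filter.2 ⟨Finset.mem_univ _, rfl, rfl⟩)) hf.injOn
    simpa [two_mul] using h3
  have h3 := Finset.card_filter_add_card_filter_not (s := Finset.univ)
    (fun q : Cell n ⊕ Cell n => IsExcluded q)
  rw [Finset.card_univ, Fintype.card_sum] at h3
  omega

end Counting

end TypeL

/-! ### Bases and dimensions -/

namespace TypeL
open Quiver PathAlgebra

variable (K : Type*) [Field K] (p : K[X]) {n : ℕ} (hn : 0 + 1 < n)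

include hn in
lemma linearIndependent_stdElt : LinearIndependent K (stdElt K p n) := by
  obtain ⟨τ, hcomm, hee, hne, heq, -⟩ := exists_oddTrace K p n
  rw [Fintype.linearIndependent_iff]
  intro g hg i
  have := coeff_eq_zero_of_oddTrace (τ := τ) (by omega) hcomm hee (fun c d => hne c d _)
    (fun c => heq c _) g fun w => by rw [hg, zero_mul, map_zero]; rfl
  exact congrFun this i

/-- The basis `𝓑` of `L_n^p`, indexed by cells. -/
def cellBasis : Module.Basis (Cell n ⊕ Cell n) K (L K n p) :=
  Module.Basis.mk (linearIndependent_stdElt K p hn) (top_le_span_stdElt K p hn)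

/-- The indexing of `𝓑` by cells. -/
def stdEquiv : (Cell n ⊕ Cell n) ≃ {x : TotalPath (Vertex n) // IsStandard x} :=
  Equiv.ofBijective (fun q => ⟨std q, isStandard_std q⟩)
    -- Different cells give different paths because their classes are linearly independent.
    ⟨fun _ _ h => (linearIndependent_stdElt K p hn).injective
        (congrArg (fun x : {x // IsStandard x} => proj K n p (ofTotal K x.1)) h),
      fun x => (exists_std_eq x.2).imp fun _ h => Subtype.ext h⟩

include hn in
lemma exists_basis_isStandard :
    ∃ b : Module.Basis {x : TotalPath (Vertex n) // IsStandard x} K (L K n p),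
      ∀ x, b x = proj K n p (ofTotal K x.1) := by
  refine ⟨(cellBasis K p hn).reindex (stdEquiv K p hn), fun x => ?_⟩
  obtain ⟨q, rfl⟩ := (stdEquiv K p hn).surjective x
  rw [Module.Basis.reindex_apply, Equiv.symm_apply_apply, cellBasis, Module.Basis.mk_apply]
  rfl

include hn in
lemma finiteDimensional_L : Module.Finite K (L K n p) := Module.Finite.of_basis (cellBasis K p hn)

include hn in
lemma finrank_L : Module.finrank K (L K n p) = 2 * Fintype.card (Cell n) := by
  rw [Module.finrank_eq_card_basis (cellBasis K p hn), Fintype.card_sum, two_mul]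

include hn in
-- The characters together with `τ` define a surjection onto `K^n × K^n` that kills commutators. The
-- characters see the trivial paths, while the odd closed paths at `0` have zero character and map
-- under `τ` to multiples of the unit vectors.
lemma finrank_quotient_ge :
    2 * n ≤ Module.finrank K (L K n p ⧸ commutatorSpace K (L K n p)) := by
  have := finiteDimensional_L K p hn
  obtain ⟨τ, hcomm, -, -, -, hτ⟩ := exists_oddTrace K p n
  obtain ⟨χ, hχ, hχε⟩ := exists_character K p (n := n)
  let Ψ : L K n p →ₗ[K] (Vertex n → K) × (Fin n → K) := χ.toLinearMap.prod τ
  have hker : commutatorSpace K (L K n p) ≤ LinearMap.ker Ψ := by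
    rw [commutatorSpace, Submodule.span_le]
    rintro _ ⟨u, v, rfl⟩
    refine Prod.ext ?_ ?_
    · change χ (u * v - v * u) = 0
      rw [map_sub, map_mul, map_mul, mul_comm, sub_self]
    · change τ (u * v - v * u) = 0
      rw [map_sub, hcomm, sub_self]
  have hodd : ∀ c : Cell n, χ (stdElt K p n (.inr c)) = 0 := by
    intro c
    rw [stdElt_odd K p hn, map_smul, Gens.odd, map_mul, map_mul, map_mul,
      ← cls_eps K p hn (Nat.lt_of_succ_lt hn), hχε, mul_zero, zero_mul, zero_mul, smul_zero]
  have hsurj : Function.Surjective Ψ := by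
    have h2 : ∀ g : Fin n → K, ∃ z, χ z = 0 ∧ τ z = g := by
      intro g
      let c : Fin n → Cell n := fun m => ⟨m, 0, 0, Nat.zero_le _, Nat.zero_le _, m.2⟩
      refine ⟨∑ m, (g m * (oddSgn K (c m))⁻¹) • stdElt K p n (.inr (c m)), ?_, ?_⟩
      · rw [map_sum]
        exact Finset.sum_eq_zero fun m _ => by rw [map_smul, hodd, smul_zero]
      · rw [map_sum]
        refine Eq.trans ?_ (Finset.univ_sum_single g)
        refine Finset.sum_congr rfl fun m _ => ?_
        rw [map_smul, hτ (c m) rfl, smul_smul, mul_assoc, inv_mul_cancel₀ (oddSgn_ne_zero K _),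
          mul_one, ← Pi.single_smul, smul_eq_mul, mul_one]
    rintro ⟨f, g⟩
    let z : L K n p := ∑ i, f i • cls K p (Path.nil : Path i i)
    have hz : χ z = f := by
      rw [map_sum]
      refine Eq.trans ?_ (Finset.univ_sum_single f)
      refine Finset.sum_congr rfl fun i _ => ?_
      rw [map_smul, hχ, ← Pi.single_smul, smul_eq_mul, mul_one]
    -- The first component is hit by trivial paths; `w` corrects the second without changing the
    -- first.
    obtain ⟨w, hw1, hw2⟩ := h2 (g - τ z)
    refine ⟨z + w, Prod.ext ?_ ?_⟩
    · change χ (z + w) = f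
      rw [map_add, hw1, hz, add_zero]
    · change τ (z + w) = g
      rw [map_add, hw2, add_sub_cancel]
  have h := LinearMap.finrank_le_finrank_of_surjective
    (f := (commutatorSpace K (L K n p)).liftQ Ψ hker)
    (fun y => by
      obtain ⟨z, hz⟩ := hsurj y
      exact ⟨Submodule.Quotient.mk z, hz⟩)
  have hV : Fintype.card (Vertex n) = n := by
    rw [Fintype.card_congr ⟨fun v => (⟨v.1, v.2⟩ : Fin n), fun i => ⟨i.1, i.2⟩, fun _ => rfl,
      fun _ => rfl⟩, Fintype.card_fin]
  rw [Module.finrank_prod, Module.finrank_pi, Module.finrank_pi, hV, Fintype.card_fin] at h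
  omega

lemma top_le_span_quotElt : ⊤ ≤ Submodule.span K (Set.range fun q =>
    (Submodule.Quotient.mk (quotElt K p hn q) : L K n p ⧸ commutatorSpace K (L K n p))) := by
  have h : commutatorSpace K (L K n p) ⊔ Submodule.span K (Set.range (quotElt K p hn)) = ⊤ := by
    rw [eq_top_iff, ← commSpan_sup_eq_top K p hn]
    exact sup_le_sup_right (commSpan_le K p hn) _
  have h2 := congrArg (Submodule.map (commutatorSpace K (L K n p)).mkQ) h
  rw [Submodule.map_sup, Submodule.mkQ_map_self, bot_sup_eq, Submodule.map_top,
    Submodule.range_mkQ, Submodule.map_span, ← Set.range_comp] at h2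
  exact h2.ge

include hn in
lemma finrank_quotient :
    Module.finrank K (L K n p ⧸ commutatorSpace K (L K n p)) = 2 * n := by
  refine le_antisymm ?_ (finrank_quotient_ge K p hn)
  have h := finrank_range_le_card (R := K) (fun q =>
    (Submodule.Quotient.mk (quotElt K p hn q) : L K n p ⧸ commutatorSpace K (L K n p)))
  rw [Set.finrank, top_le_iff.1 (top_le_span_quotElt K p hn), finrank_top, Fintype.card_sum,
    Fintype.card_fin] at h
  omega

/-- The basis of the quotient by the commutator space. -/
def quotBasis : Module.Basis (Fin n ⊕ Fin n) K (L K n p ⧸ commutatorSpace K (L K n p)) :=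
  basisOfTopLeSpanOfCardEqFinrank _ (top_le_span_quotElt K p hn)
    (by rw [finrank_quotient K p hn, Fintype.card_sum, Fintype.card_fin, two_mul])

lemma quotBasis_apply (q : Fin n ⊕ Fin n) :
    quotBasis K p hn q = Submodule.Quotient.mk (quotElt K p hn q) := by
  rw [quotBasis, coe_basisOfTopLeSpanOfCardEqFinrank]

include hn in
lemma finrank_commutatorSpace :
    Module.finrank K (commutatorSpace K (L K n p)) + 2 * n = Module.finrank K (L K n p) := by
  have := finiteDimensional_L K p hn
  rw [← Submodule.finrank_quotient_add_finrank (commutatorSpace K (L K n p)),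
    finrank_quotient K p hn, add_comm]

include hn in
-- The span together with `2n` further elements fills the algebra, so its dimension is at least that
-- of the commutator space containing it.
lemma commSpan_eq : commSpan K p n = commutatorSpace K (L K n p) := by
  have := finiteDimensional_L K p hn
  refine Submodule.eq_of_le_of_finrank_le (commSpan_le K p hn) ?_
  have h1 := Submodule.finrank_add_le_finrank_add_finrank (commSpan K p n)
    (Submodule.span K (Set.range (quotElt K p hn)))
  rw [commSpan_sup_eq_top, finrank_top] at h1
  have h2 := finrank_range_le_card (R := K) (quotElt K p hn)
  rw [Set.finrank, Fintype.card_sum, Fintype.card_fin] at h2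
  have h3 := finrank_commutatorSpace K p hn
  omega

include hn in
-- A spanning family with no more members than the dimension is linearly independent, so the upper
-- bound from the count is enough.
lemma exists_basis_commutatorSpace :
    ∃ b : Module.Basis {x : PathAlgebra K (Vertex n) // IsCommutatorBasisElt K n x}
        K (commutatorSpace K (L K n p)), ∀ x, (b x : L K n p) = proj K n p x.1 := by
  have := Fintype.ofFinite {x : PathAlgebra K (Vertex n) // IsCommutatorBasisElt K n x}
  have hli : LinearIndependent K
      fun x : {x : PathAlgebra K (Vertex n) // IsCommutatorBasisElt K n x} => proj K n p x.1 := by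
    rw [linearIndependent_iff_card_le_finrank_span, Set.finrank]
    change _ ≤ Module.finrank K (commSpan K p n)
    have h1 := card_commElt_add_le K (n := n)
    have h2 := finrank_commutatorSpace K p hn
    rw [Nat.card_eq_fintype_card] at h1
    rw [finrank_L K p hn] at h2
    rw [commSpan_eq K p hn]
    omega
  have hspan : Submodule.span K (Set.range fun x : {x : PathAlgebra K (Vertex n) //
      IsCommutatorBasisElt K n x} => proj K n p x.1) = commutatorSpace K (L K n p) :=
    commSpan_eq K p hn
  refine ⟨(Module.Basis.span hli).map (LinearEquiv.ofEq _ _ hspan), fun x => ?_⟩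
  rw [Module.Basis.map_apply, LinearEquiv.coe_ofEq_apply, Module.Basis.span_apply]

include hn in
-- The coordinate `n - 1` of `τ` makes the algebra symmetric, so the centre has the codimension of
-- the commutator space as its dimension.
lemma finrank_center :
    Module.finrank K (Subalgebra.center K (L K n p)) = 2 * n := by
  have := finiteDimensional_L K p hn
  obtain ⟨τ, hcomm, hee, hne, heq, -⟩ := exists_oddTrace K p n
  have h : n - 1 < n := by omega
  have h1 := finrank_commutatorSpace K p hn
  rw [finrank_center_of_symmetric (LinearMap.proj (⟨n - 1, h⟩ : Fin n) ∘ₗ τ)]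
  · omega
  · intro u v
    exact congrFun (hcomm u v) _
  · intro u hu
    have hsum : ∑ q, (cellBasis K p hn).repr u q • stdElt K p n q = u := by
      have := (cellBasis K p hn).sum_repr u
      rwa [cellBasis, Module.Basis.coe_mk] at this
    have h0 := coeff_eq_zero_of_oddTrace (τ := τ) h hcomm hee (fun c d => hne c d h)
      (fun c => heq c h) (fun q => (cellBasis K p hn).repr u q) fun w => by
        rw [hsum]; exact hu w
    rw [← hsum]
    exact Finset.sum_eq_zero fun q _ => by rw [congrFun h0 q]; exact zero_smul _ _

end TypeL
end

theorem mainTheorem3 (K : Type*) [Field K] (p : K[X]) (n : ℕ) (hn : 2 ≤ n) :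
    -- the paths in `𝓑` form a basis of `L_n^p`
    (∃ b : Module.Basis {x : TotalPath (TypeL.Vertex n) // TypeL.IsStandard x} K (TypeL.L K n p),
      ∀ x, b x = TypeL.proj K n p (PathAlgebra.ofTotal K x.1)) ∧
    -- dimension of the algebra and of its commutator space
    Module.Finite K (TypeL.L K n p) ∧
    (Module.finrank K (commutatorSpace K (TypeL.L K n p)) : ℚ)
      = (Module.finrank K (TypeL.L K n p) : ℚ) - 2 * n ∧
    (Module.finrank K (commutatorSpace K (TypeL.L K n p)) : ℚ)
      = 1 / 3 * n * (n - 1) * (2 * n + 5) ∧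
    -- dimension of the centre
    Module.finrank K (Subalgebra.center K (TypeL.L K n p)) = 2 * n ∧
    -- the cosets of `e_0, …, e_{n-1}, ε, ε³, …, ε^{2n-1}` form a basis of `L_n^p / [L_n^p, L_n^p]`
    (∃ b : Module.Basis (Fin n ⊕ Fin n) K
        (TypeL.L K n p ⧸ commutatorSpace K (TypeL.L K n p)),
      (∀ i : Fin n, b (Sum.inl i) = Submodule.Quotient.mk (TypeL.proj K n p
        (PathAlgebra.ofPath K
          (Quiver.Path.nil : Quiver.Path (⟨i, i.2⟩ : TypeL.Vertex n) ⟨i, i.2⟩)))) ∧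
      (∀ l : Fin n, b (Sum.inr l) = Submodule.Quotient.mk (TypeL.proj K n p
        (PathAlgebra.ofPath K (TypeL.eps (Nat.zero_lt_of_lt hn))) ^ (2 * (l : ℕ) + 1)))) ∧
    -- explicit basis of the commutator space
    (∃ b : Module.Basis {x : PathAlgebra K (TypeL.Vertex n) // TypeL.IsCommutatorBasisElt K n x}
        K (commutatorSpace K (TypeL.L K n p)),
      ∀ x, (b x : TypeL.L K n p) = TypeL.proj K n p x.1) := by
  have hn' : 0 + 1 < n := hn
  have h1 := TypeL.finrank_commutatorSpace K p hn'
  have h2 : (Module.finrank K (commutatorSpace K (TypeL.L K n p)) : ℚ)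
      = (Module.finrank K (TypeL.L K n p) : ℚ) - 2 * n := by
    rw [← h1]
    push_cast
    ring
  refine ⟨TypeL.exists_basis_isStandard K p hn', TypeL.finiteDimensional_L K p hn', h2, ?_,
    TypeL.finrank_center K p hn', ⟨TypeL.quotBasis K p hn', fun i => ?_, fun l => ?_⟩,
    TypeL.exists_basis_commutatorSpace K p hn'⟩
  · rw [h2, TypeL.finrank_L K p hn']
    push_cast
    rw [TypeL.Cell.card_cell]
    ring
  · rw [TypeL.quotBasis_apply]
    rfl
  · rw [TypeL.quotBasis_apply]
    rfl
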